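/- Let $0<q<1$, $v>-1$ and $a=q^n$ with $n\in\mathbb Z$; put $\mathbb R_q=\{\pm q^s: s\in\mathbb Z\}$ and $[0,a]_q=\{q^s: s\in\mathbb Z,\ s\ge n\}$. Jackson's integrals are $$\int_0^a f(x)\,d_qx=(1-q)a\sum_{k\ge0}q^kf(aq^k),\qquad \int_0^\infty f(x)\,d_qx=(1-q)\sum_{s\in\mathbb Z}q^sf(q^s).$$ Let $\mathcal L_{q,2,v}$ be the space of real-valued even functions $f$ on $\mathbb R_q$ with $\int_0^\infty|f(x)|^2x^{2v+1}d_qx<\infty$, with inner product $\langle f,g\rangle=\int_0^\infty f(t)g(t)t^{2v+1}d_qt$, and $\mathcal L_{q,v,a}$ the space of real-valued functions on $[0,a]_q$ with $\int_0^a|f(x)|^2x^{2v+1}d_qx<\infty$, with inner product $\int_0^af(t)g(t)t^{2v+1}d_qt$. With $(z;q)_m=\prod_{i=0}^{m-1}(1-zq^i)$ $(0\le m\le\infty)$, let $$j_v(z,q)=\sum_{m\ge0}(-1)^m\frac{q^{m(m+1)/2}}{(q;q)_m(q^{v+1};q)_m}z^{2m},\qquad c_{q,v}=\frac1{1-q}\,\frac{(q^{2v+2};q^2)_\infty}{(q^2;q^2)_\infty},$$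 $$PW_{q,a}^v=\Big\{f:\mathbb R_q\to\mathbb R\ :\ f(x)=\int_0^au(t)j_v(xt,q^2)t^{2v+1}d_qt,\ u\in\mathcal L_{q,v,a}\Big\}.$$ Then $T_a^vu(x)=c_{q,v}\int_0^au(t)j_v(xt,q^2)t^{2v+1}d_qt$ defines a compact symmetric operator on $\mathcal L_{q,v,a}$. Call $(\psi_i)_{i\in\mathbb N}$ a system of ($L^2$-normalized) $q$-prolate spheroidal wave functions if there are eigenfunctions $u_i\in\mathcal L_{q,v,a}$ of $T_a^v$, $T_a^vu_i=\lambda_iu_i$, such that $u_i\perp u_j$ whenever $i\ne j$ and $\lambda_i=\lambda_j$, such that every eigenfunction of $T_a^v$ is a finite linear combination of the $u_i$, and such that $\psi_i$ is the extension of $u_i$ to $\mathbb R_q$ given by $$\psi_i(x)=\frac{1}{\lambda_i}c_{q,v}\int_0^au_i(t)j_v(xt,q^2)t^{2v+1}d_qt\quad(x\in\mathbb R_q),\qquad \int_0^\infty\psi_i(t)^2t^{2v+1}d_qt=1$$ (in particular $\lambda_i\neq0$). Such a system exists, and can be ordered so that $\lambda_0^2\ge\lambda_1^2\ge\dots$.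 For every such system, $\psi_i=u_i$ on $[0,a]_q$, the functions $u_i$ form an orthogonal basis of $\mathcal L_{q,v,a}$, the set $PW_{q,a}^v$ is a linear subspace of $\mathcal L_{q,2,v}$, and $(\psi_i)_{i\in\mathbb N}$ is an orthonormal (Hilbert) basis of $PW_{q,a}^v$. -/

import Mathlib

noncomputable section

namespace QFourier

/-- `ℝ_q = {± q^n : n ∈ ℤ}`. -/
def Rq (q : Set.Ioo (0 : ℝ) 1) : Set ℝ := {x | ∃ s : ℤ, x = (q : ℝ) ^ s ∨ x = -(q : ℝ) ^ s}

/-- `[0, a]_q = {q^s : s ∈ ℤ, s ≥ n}` for the endpoint `a = q^n`, `n ∈ ℤ`. -/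
def qInterval (q : Set.Ioo (0 : ℝ) 1) (n : ℤ) : Set ℝ := {x | ∃ s : ℤ, n ≤ s ∧ x = (q : ℝ) ^ s}

/-- The point `q^s` of `ℝ_q`. -/
def RqNode (q : Set.Ioo (0 : ℝ) 1) (s : ℤ) : Rq q := ⟨(q : ℝ) ^ s, s, Or.inl rfl⟩

/-- The point `a q^k` of `[0, a]_q`, where `a = q^n`. -/
def qIntervalNode (q : Set.Ioo (0 : ℝ) 1) (n : ℤ) (k : ℕ) : qInterval q n :=
  ⟨(q : ℝ) ^ n * (q : ℝ) ^ k, n + k, by omega, by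
    rw [zpow_add₀ (ne_of_gt q.2.1), zpow_natCast]⟩

/-- Jackson's `q`-integral `∫_0^a f(x) d_q x = (1 - q) a ∑_{k ≥ 0} q^k f(a q^k)`, `a = q^n`. -/
def jacksonIcc (q : Set.Ioo (0 : ℝ) 1) (n : ℤ) (f : qInterval q n → ℝ) : ℝ :=
  (1 - (q : ℝ)) * (q : ℝ) ^ n * ∑' k : ℕ, (q : ℝ) ^ k * f (qIntervalNode q n k)

/-- Jackson's `q`-integral `∫_0^∞ f(x) d_q x = (1 - q) ∑_{s ∈ ℤ} q^s f(q^s)`. -/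
def jacksonIoi (q : Set.Ioo (0 : ℝ) 1) (f : Rq q → ℝ) : ℝ :=
  (1 - (q : ℝ)) * ∑' s : ℤ, (q : ℝ) ^ s * f (RqNode q s)

/-- `(z; q)_n = ∏_{i < n} (1 - z q^i)`. -/
def qPoch (z q : ℝ) (n : ℕ) : ℝ := ∏ i ∈ Finset.range n, (1 - z * q ^ i)

/-- `(z; q)_∞ = ∏_{i ≥ 0} (1 - z q^i)`. -/
def qPochInf (z q : ℝ) : ℝ := ∏' i : ℕ, (1 - z * q ^ i)

/-- The normalized Hahn-Exton `q`-Bessel function `j_v(z, q)`. -/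
def besselJ (v z q : ℝ) : ℝ :=
  ∑' n : ℕ, (-1) ^ n * (q ^ (n * (n + 1) / 2) / (qPoch q q n * qPoch (q ^ (v + 1)) q n)) *
    z ^ (2 * n)

/-- The constant `c_{q,v} = (q^{2v+2}; q²)_∞ / ((1 - q) (q²; q²)_∞)`. -/
def cConst (q : Set.Ioo (0 : ℝ) 1) (v : ℝ) : ℝ :=
  1 / (1 - (q : ℝ)) * (qPochInf ((q : ℝ) ^ (2 * v + 2)) ((q : ℝ) ^ 2) /
    qPochInf ((q : ℝ) ^ 2) ((q : ℝ) ^ 2))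

theorem summable_mul_of_sq {ι : Type*} {w f g : ι → ℝ} (hw : ∀ i, 0 ≤ w i)
    (hf : Summable fun i => w i * f i ^ 2) (hg : Summable fun i => w i * g i ^ 2) :
    Summable fun i => w i * (f i * g i) := by
  refine Summable.of_norm_bounded (hf.add hg) fun i => ?_
  rw [Real.norm_eq_abs, abs_mul, abs_of_nonneg (hw i), ← mul_add]
  refine mul_le_mul_of_nonneg_left ?_ (hw i)
  rw [abs_le]
  constructor <;> nlinarith [sq_nonneg (f i + g i), sq_nonneg (f i - g i), sq_nonneg (f i),
    sq_nonneg (g i)]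

theorem summable_add_sq {ι : Type*} {w f g : ι → ℝ} (hw : ∀ i, 0 ≤ w i)
    (hf : Summable fun i => w i * f i ^ 2) (hg : Summable fun i => w i * g i ^ 2) :
    Summable fun i => w i * (f i + g i) ^ 2 := by
  refine ((hf.add hg).add ((summable_mul_of_sq hw hf hg).mul_left 2)).congr fun i => ?_
  ring

theorem summable_smul_sq {ι : Type*} {w f : ι → ℝ} (c : ℝ)
    (hf : Summable fun i => w i * f i ^ 2) :
    Summable fun i => w i * (c * f i) ^ 2 := by
  refine (hf.mul_left (c ^ 2)).congr fun i => ?_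
  ring

/-- The weight of the point `a q^k` in `∫_0^a (⋯) x^{2v+1} d_q x`, without `(1 - q) a`. -/
def wIcc (q : Set.Ioo (0 : ℝ) 1) (v : ℝ) (n : ℤ) (k : ℕ) : ℝ :=
  (q : ℝ) ^ k * (qIntervalNode q n k : ℝ) ^ (2 * v + 1)

/-- The weight of the point `q^s` in `∫_0^∞ (⋯) x^{2v+1} d_q x`, without `1 - q`. -/
def wIoi (q : Set.Ioo (0 : ℝ) 1) (v : ℝ) (s : ℤ) : ℝ :=
  (q : ℝ) ^ s * (RqNode q s : ℝ) ^ (2 * v + 1)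

theorem wIcc_pos (q : Set.Ioo (0 : ℝ) 1) (v : ℝ) (n : ℤ) (k : ℕ) : 0 < wIcc q v n k :=
  mul_pos (pow_pos q.2.1 _)
    (Real.rpow_pos_of_pos (mul_pos (zpow_pos q.2.1 _) (pow_pos q.2.1 _)) _)

theorem wIoi_pos (q : Set.Ioo (0 : ℝ) 1) (v : ℝ) (s : ℤ) : 0 < wIoi q v s :=
  mul_pos (zpow_pos q.2.1 _) (Real.rpow_pos_of_pos (zpow_pos q.2.1 _) _)

/-- Functions on `[0, a]_q`, `a = q^n`, with `∫_0^a |f(x)|² x^{2v+1} d_q x < ∞`. -/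
def subIcc (q : Set.Ioo (0 : ℝ) 1) (v : ℝ) (n : ℤ) : Submodule ℝ (qInterval q n → ℝ) where
  carrier := {f | Summable fun k : ℕ => wIcc q v n k * f (qIntervalNode q n k) ^ 2}
  add_mem' hf hg := summable_add_sq (fun k => (wIcc_pos q v n k).le) hf hg
  zero_mem' := by simp
  smul_mem' c _ hf := summable_smul_sq c hf

/-- Even functions on `ℝ_q` with `∫_0^∞ |f(x)|² x^{2v+1} d_q x < ∞`. -/
def subIoi (q : Set.Ioo (0 : ℝ) 1) (v : ℝ) : Submodule ℝ (Rq q → ℝ) where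
  carrier := {f | (∀ x y : Rq q, (x : ℝ) = -(y : ℝ) → f x = f y) ∧
    Summable fun s : ℤ => wIoi q v s * f (RqNode q s) ^ 2}
  add_mem' hf hg := ⟨fun x y h => congrArg₂ (· + ·) (hf.1 x y h) (hg.1 x y h),
    summable_add_sq (fun s => (wIoi_pos q v s).le) hf.2 hg.2⟩
  zero_mem' := ⟨fun _ _ _ => rfl, by simp⟩
  smul_mem' c _ hf := ⟨fun x y h => congrArg (c * ·) (hf.1 x y h), summable_smul_sq c hf.2⟩

/-- The Hilbert space `L_{q,v,a}` of square integrable functions on `[0, a]_q`, `a = q^n`. -/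
def LIcc (q : Set.Ioo (0 : ℝ) 1) (v : ℝ) (n : ℤ) : Type := subIcc q v n

/-- The Hilbert space `L_{q,2,v}` of square integrable even functions on `ℝ_q`. -/
def LIoi (q : Set.Ioo (0 : ℝ) 1) (v : ℝ) : Type := subIoi q v

variable {q : Set.Ioo (0 : ℝ) 1} {v : ℝ} {n : ℤ}

instance : AddCommGroup (LIcc q v n) := inferInstanceAs (AddCommGroup (subIcc q v n))
instance : Module ℝ (LIcc q v n) := inferInstanceAs (Module ℝ (subIcc q v n))
instance : CoeFun (LIcc q v n) (fun _ => qInterval q n → ℝ) := ⟨fun f => f.1⟩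

instance : AddCommGroup (LIoi q v) := inferInstanceAs (AddCommGroup (subIoi q v))
instance : Module ℝ (LIoi q v) := inferInstanceAs (Module ℝ (subIoi q v))
instance : CoeFun (LIoi q v) (fun _ => Rq q → ℝ) := ⟨fun f => f.1⟩

theorem sumIcc (f g : LIcc q v n) : Summable fun k : ℕ =>
    (q : ℝ) ^ k * (f (qIntervalNode q n k) * g (qIntervalNode q n k) *
      (qIntervalNode q n k : ℝ) ^ (2 * v + 1)) := by
  refine (summable_mul_of_sq (fun k => (wIcc_pos q v n k).le) f.2 g.2).congr fun k => ?_
  simp only [wIcc]; ring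

theorem sumIoi (f g : LIoi q v) : Summable fun s : ℤ =>
    (q : ℝ) ^ s * (f (RqNode q s) * g (RqNode q s) * (RqNode q s : ℝ) ^ (2 * v + 1)) := by
  refine (summable_mul_of_sq (fun s => (wIoi_pos q v s).le) f.2.2 g.2.2).congr fun s => ?_
  simp only [wIoi]; ring

/-- The inner product `⟨f, g⟩ = ∫_0^a f(t) g(t) t^{2v+1} d_q t` of `L_{q,v,a}`. -/
instance : Inner ℝ (LIcc q v n) :=
  ⟨fun f g => jacksonIcc q n fun t => f t * g t * (t : ℝ) ^ (2 * v + 1)⟩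

/-- The inner product `⟨f, g⟩ = ∫_0^∞ f(t) g(t) t^{2v+1} d_q t` of `L_{q,2,v}`. -/
instance : Inner ℝ (LIoi q v) :=
  ⟨fun f g => jacksonIoi q fun t => f t * g t * (t : ℝ) ^ (2 * v + 1)⟩

theorem eq_zero_of_weighted {ι : Type*} {C : ℝ} (hC : 0 < C) {w h : ι → ℝ} (hw : ∀ i, 0 < w i)
    (hs : Summable fun i => w i * h i ^ 2) (h0 : C * ∑' i, w i * h i ^ 2 = 0) (i : ι) :
    h i = 0 := by
  have h1 : ∑' i, w i * h i ^ 2 = 0 := by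
    rcases mul_eq_zero.1 h0 with h | h
    · exact absurd h hC.ne'
    · exact h
  have h2 := (hs.hasSum_iff.2 h1)
  have h3 := (hasSum_zero_iff_of_nonneg
    (fun i => mul_nonneg (hw i).le (sq_nonneg (h i)))).1 h2
  have h4 := congrFun h3 i
  simpa [(hw i).ne'] using h4

/-- The inner product axioms for `L_{q,v,a}`. -/
abbrev coreIcc (q : Set.Ioo (0 : ℝ) 1) (v : ℝ) (n : ℤ) : InnerProductSpace.Core ℝ (LIcc q v n) where
  inner := inner ℝ
  conj_inner_symm f g := by
    simp only [inner, conj_trivial]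
    congr 1; funext t; ring
  re_inner_nonneg f := by
    simp only [inner, RCLike.re_to_real, jacksonIcc]
    refine mul_nonneg (mul_nonneg (by linarith [q.2.2]) (zpow_pos q.2.1 _).le)
      (tsum_nonneg fun k => ?_)
    have := mul_nonneg (wIcc_pos q v n k).le (sq_nonneg (f (qIntervalNode q n k)))
    simp only [wIcc] at this
    nlinarith [this]
  add_left f g h := by
    simp only [inner, jacksonIcc]
    rw [← mul_add, ← (sumIcc f h).tsum_add (sumIcc g h)]
    congr 2; funext k
    change _ * ((f _ + g _) * _ * _) = _
    ring
  smul_left f g c := by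
    simp only [inner, jacksonIcc, conj_trivial]
    rw [mul_left_comm, ← tsum_mul_left (a := c)]
    congr 2; funext k
    change _ * ((c * f _) * _ * _) = _
    ring
  definite f h := by
    simp only [inner, jacksonIcc] at h
    have hC : 0 < (1 - (q : ℝ)) * (q : ℝ) ^ n :=
      mul_pos (by linarith [q.2.2]) (zpow_pos q.2.1 _)
    have h' := eq_zero_of_weighted hC (wIcc_pos q v n) f.2 (by
      refine Eq.trans ?_ h
      congr 2; funext k; simp only [wIcc]; ring)
    refine Subtype.ext (funext fun x => ?_)
    obtain ⟨x, s, hs, rfl⟩ := x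
    obtain ⟨k, rfl⟩ := Int.le.dest hs
    have hx : qIntervalNode q n k = ⟨(q : ℝ) ^ (n + (k : ℤ)), n + k, hs, rfl⟩ :=
      Subtype.ext ((by rw [zpow_add₀ (ne_of_gt q.2.1), zpow_natCast] :
        (q : ℝ) ^ n * (q : ℝ) ^ k = (q : ℝ) ^ (n + (k : ℤ))))
    exact (congrArg f.1 hx).symm.trans (h' k)

/-- The inner product axioms for `L_{q,2,v}`. -/
abbrev coreIoi (q : Set.Ioo (0 : ℝ) 1) (v : ℝ) : InnerProductSpace.Core ℝ (LIoi q v) where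
  inner := inner ℝ
  conj_inner_symm f g := by
    simp only [inner, conj_trivial]
    congr 1; funext t; ring
  re_inner_nonneg f := by
    simp only [inner, RCLike.re_to_real, jacksonIoi]
    refine mul_nonneg (by linarith [q.2.2]) (tsum_nonneg fun s => ?_)
    have := mul_nonneg (wIoi_pos q v s).le (sq_nonneg (f (RqNode q s)))
    simp only [wIoi] at this
    nlinarith [this]
  add_left f g h := by
    simp only [inner, jacksonIoi]
    rw [← mul_add, ← (sumIoi f h).tsum_add (sumIoi g h)]
    congr 2; funext s
    change _ * ((f _ + g _) * _ * _) = _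
    ring
  smul_left f g c := by
    simp only [inner, jacksonIoi, conj_trivial]
    rw [mul_left_comm, ← tsum_mul_left (a := c)]
    congr 2; funext s
    change _ * ((c * f _) * _ * _) = _
    ring
  definite f h := by
    simp only [inner, jacksonIoi] at h
    have hC : 0 < 1 - (q : ℝ) := by linarith [q.2.2]
    have h' := eq_zero_of_weighted hC (wIoi_pos q v) f.2.2 (by
      refine Eq.trans ?_ h
      congr 2; funext s; simp only [wIoi]; ring)
    refine Subtype.ext (funext fun x => ?_)
    obtain ⟨x, s, hs⟩ := x
    rcases hs with rfl | rfl
    · exact h' s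
    · exact (f.2.1 _ (RqNode q s) rfl).trans (h' s)

instance : NormedAddCommGroup (LIcc q v n) := (coreIcc q v n).toNormedAddCommGroup
instance : InnerProductSpace ℝ (LIcc q v n) := InnerProductSpace.ofCore (coreIcc q v n).toCore

instance : NormedAddCommGroup (LIoi q v) := (coreIoi q v).toNormedAddCommGroup
instance : InnerProductSpace ℝ (LIoi q v) := InnerProductSpace.ofCore (coreIoi q v).toCore

/-- `∫_0^a u(t) j_v(xt, q²) t^{2v+1} d_q t`, where `a = q^n`. -/
def besselInt (u : LIcc q v n) (x : ℝ) : ℝ :=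
  jacksonIcc q n fun t => u t * besselJ v (x * t) ((q : ℝ) ^ 2) * (t : ℝ) ^ (2 * v + 1)

/-- The `q`-Paley-Wiener space `PW_{q,a}^v`, `a = q^n`, as a set of functions on `ℝ_q`. -/
def PW (q : Set.Ioo (0 : ℝ) 1) (v : ℝ) (n : ℤ) : Set (Rq q → ℝ) :=
  {f | ∃ u : LIcc q v n, ∀ x : Rq q, f x = besselInt u x}

/-- `T` is the operator `T_a^v u(x) = c_{q,v} ∫_0^a u(t) j_v(xt, q²) t^{2v+1} d_q t`
on `L_{q,v,a}`, `a = q^n`. -/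
def IsProlateOperator (T : LIcc q v n →L[ℝ] LIcc q v n) : Prop :=
  ∀ (u : LIcc q v n) (x : qInterval q n), T u x = cConst q v * besselInt u x

/-- The functions `ψ_i` on `ℝ_q` are the `L²`-normalized prolate spheroidal wave functions of `T`:
`u_i` runs through the eigenfunctions of `T` on `[0, a]_q`, counted with multiplicity (those for
one and the same eigenvalue are chosen orthogonal, and every eigenfunction is a linear combination
of the `u_i`); `ψ_i` is the extension of `u_i` to `ℝ_q` by the eigenvalue equation; and
`∫_0^∞ ψ_i(t)² t^{2v+1} d_q t = 1`. -/
structure IsProlateSystem (T : LIcc q v n →L[ℝ] LIcc q v n) (lam : ℕ → ℝ)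
    (u : ℕ → LIcc q v n) (ψ : ℕ → Rq q → ℝ) : Prop where
  eigen : ∀ i, Module.End.HasEigenvector (T : LIcc q v n →ₗ[ℝ] LIcc q v n) (lam i) (u i)
  orth : ∀ i j, i ≠ j → lam i = lam j → inner ℝ (u i) (u j) = 0
  exhaust : ∀ (μ : ℝ) (w : LIcc q v n),
    Module.End.HasEigenvector (T : LIcc q v n →ₗ[ℝ] LIcc q v n) μ w →
      w ∈ Submodule.span ℝ (Set.range u)
  extend : ∀ i (x : Rq q), ψ i x = (lam i)⁻¹ * (cConst q v * besselInt (u i) x)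
  normalized : ∀ i, jacksonIoi q (fun t => ψ i t ^ 2 * (t : ℝ) ^ (2 * v + 1)) = 1

end QFourier

end

open Filter Topology

noncomputable section

namespace QFourier

/-! Put `p = q²` and `α = q^{2v+2}`. Jackson's integrals against `x^{2v+1}` are sums over the
lattice `q^s` with mass `(1-q) α^s`, and the kernel `j_v(q^s q^t, q²)` depends only on `s + t`;
write it `J(s+t)`, with `J` = `latticeJ`.

The heart of the proof is that the transform `u ↦ ∫_0^a u(t) j_v(xt, q²) t^{2v+1} d_q t` is a
constant multiple of an isometry from `L_{q,v,a}` to `L_{q,2,v}`. By the three-term recurrence of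
`J` (`latticeJ_recurrence`), two shifts of `J` solve the same second-order difference equation with
different spectral parameters, so their products are differences of a weighted Casoratian and
telescope: `tsum_zpow_mul_latticeJ_mul_latticeJ_of_ne`. The diagonal sums follow from translation of
`ℤ`. Convergence at `s → -∞` needs the super-exponential decay of `J` there, obtained from Euler's
series (`exists_abs_hahnExton_zpow_neg_le`). The constant `planchConst` only has to be positive; its
value is not needed.

The operator `T` on `L_{q,v,a}` is a norm-convergent series of rank one operators with symmetric
kernel, hence compact and symmetric. It is injective (`eq_zero_of_tsum_mul_latticeJ`), so all
eigenvalues are nonzero, and the spectral theorem makes the `u_i`, suitably scaled, a Hilbert basis.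
The Paley-Wiener space is the range of the isometry `hankel`, and `ψ_i` is the image of a multiple
of `u_i`; since `∫ ψ_i² = 1`, that multiple is a unit vector. Hence the `ψ_i` are the image of a
Hilbert basis. -/

/-! ### Estimates for `q`-shifted factorials. -/

theorem summable_pow_choose_two_mul_pow {p : ℝ} (hp0 : 0 < p) (hp1 : p < 1) (R : ℝ) :
    Summable fun m : ℕ => p ^ m.choose 2 * R ^ m := by
  have key : Summable fun m : ℕ => p ^ m.choose 2 * (|R| + 1) ^ m := by
    have hR : 0 < |R| + 1 := by positivity
    refine summable_of_ratio_test_tendsto_lt_one (l := 0) one_pos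
      (Eventually.of_forall fun m => by positivity) ?_
    have h : Tendsto (fun m : ℕ => p ^ m * (|R| + 1)) atTop (𝓝 (0 * (|R| + 1))) :=
      (tendsto_pow_atTop_nhds_zero_of_lt_one hp0.le hp1).mul_const _
    rw [zero_mul] at h
    refine h.congr fun m => ?_
    rw [Real.norm_of_nonneg (by positivity), Real.norm_of_nonneg (by positivity),
      Nat.choose_succ_succ' m 1, Nat.choose_one_right]
    field_simp
    ring
  refine Summable.of_norm_bounded key fun m => ?_
  rw [norm_mul, norm_pow, norm_pow, Real.norm_of_nonneg hp0.le, Real.norm_eq_abs]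
  gcongr
  linarith

theorem qPoch_succ (z p : ℝ) (m : ℕ) : qPoch z p (m + 1) = qPoch z p m * (1 - z * p ^ m) :=
  Finset.prod_range_succ _ _

section

variable {z p : ℝ} (hz0 : 0 ≤ z) (hz1 : z < 1) (hp0 : 0 < p) (hp1 : p < 1)
include hz0 hz1 hp0 hp1

theorem one_sub_mul_pow_pos (i : ℕ) : 0 < 1 - z * p ^ i := by
  have h : z * p ^ i ≤ z := mul_le_of_le_one_right hz0 (pow_le_one₀ hp0.le hp1.le)
  linarith

theorem qPoch_pos (m : ℕ) : 0 < qPoch z p m :=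
  Finset.prod_pos fun i _ => one_sub_mul_pow_pos hz0 hz1 hp0 hp1 i

theorem qPoch_antitone : Antitone (qPoch z p) := by
  refine antitone_nat_of_succ_le fun m => ?_
  rw [qPoch_succ]
  refine mul_le_of_le_one_right (qPoch_pos hz0 hz1 hp0 hp1 m).le ?_
  have : 0 ≤ z * p ^ m := by positivity
  linarith

omit hz0 hz1 in
theorem tendsto_qPoch : Tendsto (qPoch z p) atTop (𝓝 (qPochInf z p)) := by
  have hs : Summable fun i : ℕ => ‖-(z * p ^ i)‖ := by
    simp_rw [norm_neg]
    exact ((summable_geometric_of_lt_one hp0.le hp1).mul_left z).norm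
  have h := (multipliable_one_add_of_summable hs).hasProd.tendsto_prod_nat
  simp only [← sub_eq_add_neg] at h
  exact h

theorem qPochInf_pos : 0 < qPochInf z p := by
  have hs : Summable fun i : ℕ => ‖-(z * p ^ i)‖ := by
    simp_rw [norm_neg]
    exact ((summable_geometric_of_lt_one hp0.le hp1).mul_left z).norm
  have h0 : (∏' i : ℕ, (1 + -(z * p ^ i))) ≠ 0 := by
    refine tprod_one_add_ne_zero_of_summable (fun i => ?_) hs
    rw [← sub_eq_add_neg]
    exact (one_sub_mul_pow_pos hz0 hz1 hp0 hp1 i).ne'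
  simp only [← sub_eq_add_neg] at h0
  exact lt_of_le_of_ne (ge_of_tendsto' (tendsto_qPoch hp0 hp1)
    fun m => (qPoch_pos hz0 hz1 hp0 hp1 m).le) (Ne.symm h0)

theorem qPochInf_le_qPoch (m : ℕ) : qPochInf z p ≤ qPoch z p m :=
  (qPoch_antitone hz0 hz1 hp0 hp1).le_of_tendsto (tendsto_qPoch hp0 hp1) m

end

/-! ### Euler's series and the Hahn-Exton series in the variable `y = z²`. -/

/-- The coefficients of Euler's series for `(z; p)_∞`. -/
def eulerCoeff (p : ℝ) (m : ℕ) : ℝ := (-1) ^ m * (p ^ m.choose 2 / qPoch p p m)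

/-- Euler's series `∑ (-1)^m p^{m(m-1)/2} z^m / (p; p)_m`. -/
def eulerSeries (p z : ℝ) : ℝ := ∑' m : ℕ, eulerCoeff p m * z ^ m

/-- The series `j_v` as a function of `y = z²`, with `α = q^{v+1}` and `p = q`. -/
def hahnExton (α p y : ℝ) : ℝ :=
  ∑' m : ℕ, eulerCoeff p m * (qPoch α p m)⁻¹ * (p * y) ^ m

theorem besselJ_eq_hahnExton (v z p : ℝ) :
    besselJ v z p = hahnExton (p ^ (v + 1)) p (z ^ 2) := by
  refine tsum_congr fun m => ?_
  have h : m * (m + 1) / 2 = m + m.choose 2 := by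
    have := Nat.choose_two_right (m + 1)
    rw [Nat.choose_succ_succ' m 1, Nat.choose_one_right, Nat.add_sub_cancel] at this
    rw [this, mul_comm]
  rw [h, eulerCoeff, pow_add, mul_pow, pow_mul, div_eq_mul_inv, div_eq_mul_inv, mul_inv]
  ring

section

variable {p : ℝ} (hp0 : 0 < p) (hp1 : p < 1)
include hp0 hp1

theorem abs_eulerCoeff_le (m : ℕ) : |eulerCoeff p m| ≤ (qPochInf p p)⁻¹ * p ^ m.choose 2 := by
  rw [eulerCoeff, abs_mul, abs_pow, abs_neg, abs_one, one_pow, one_mul, abs_of_nonneg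
    (div_nonneg (pow_nonneg hp0.le _) (qPoch_pos hp0.le hp1 hp0 hp1 m).le), div_eq_mul_inv,
    mul_comm]
  gcongr
  · exact qPochInf_pos hp0.le hp1 hp0 hp1
  · exact qPochInf_le_qPoch hp0.le hp1 hp0 hp1 m

theorem eulerCoeff_succ (m : ℕ) :
    eulerCoeff p (m + 1) * (1 - p ^ (m + 1)) = -(p ^ m * eulerCoeff p m) := by
  have h1 : 1 - p ^ (m + 1) ≠ 0 := by
    have := one_sub_mul_pow_pos hp0.le hp1 hp0 hp1 m
    rw [← pow_succ'] at this
    exact this.ne'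
  have h2 := (qPoch_pos hp0.le hp1 hp0 hp1 m).ne'
  rw [eulerCoeff, eulerCoeff, qPoch_succ, Nat.choose_succ_succ' m 1, Nat.choose_one_right,
    ← pow_succ']
  field_simp
  ring

theorem summable_abs_eulerCoeff (z : ℝ) : Summable fun m : ℕ => |eulerCoeff p m * z ^ m| := by
  refine Summable.of_nonneg_of_le (fun m => abs_nonneg _) (fun m => ?_)
    ((summable_pow_choose_two_mul_pow hp0 hp1 |z|).mul_left (qPochInf p p)⁻¹)
  rw [abs_mul, abs_pow, ← mul_assoc]
  gcongr
  exact abs_eulerCoeff_le hp0 hp1 m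

theorem summable_eulerSeries (z : ℝ) : Summable fun m : ℕ => eulerCoeff p m * z ^ m :=
  (summable_abs_eulerCoeff hp0 hp1 z).of_abs

/-- Coefficient comparison via `eulerCoeff_succ`. This functional equation stands in for Euler's
product formula `(z; p)_∞`, which is never needed. -/
theorem eulerSeries_eq (z : ℝ) : eulerSeries p z = (1 - z) * eulerSeries p (p * z) := by
  have h1 := summable_eulerSeries hp0 hp1 z
  have h2 := summable_eulerSeries hp0 hp1 (p * z)
  have h3 : eulerSeries p z - eulerSeries p (p * z) = -z * eulerSeries p (p * z) := by
    unfold eulerSeries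
    rw [← h1.tsum_sub h2, (h1.sub h2).tsum_eq_zero_add, ← tsum_mul_left]
    simp only [pow_zero, sub_self, zero_add]
    refine tsum_congr fun m => ?_
    have := eulerCoeff_succ hp0 hp1 m
    linear_combination (z ^ (m + 1)) * this
  linear_combination h3

/-- The factor `1 - z` vanishes at `z = 1`, and the functional equation carries the zero to `p^{-1},
p^{-2}, …`. -/
theorem eulerSeries_zpow_neg (j : ℕ) : eulerSeries p (p ^ (-(j : ℤ))) = 0 := by
  induction j with
  | zero => rw [eulerSeries_eq hp0 hp1]; simp
  | succ j ih =>
    rw [eulerSeries_eq hp0 hp1, ← zpow_one_add₀ hp0.ne']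
    have : 1 + -((j + 1 : ℕ) : ℤ) = -(j : ℤ) := by push_cast; ring
    rw [this, ih, mul_zero]

theorem eulerSeries_eq_qPoch_mul (z : ℝ) (m : ℕ) :
    eulerSeries p z = qPoch z p m * eulerSeries p (z * p ^ m) := by
  induction m with
  | zero => simp [qPoch]
  | succ m ih =>
    rw [ih, eulerSeries_eq hp0 hp1 (z * p ^ m), qPoch_succ, pow_succ]
    ring_nf

theorem abs_eulerSeries_le {z : ℝ} (hz : |z| ≤ 1) :
    |eulerSeries p z| ≤ ∑' m : ℕ, |eulerCoeff p m| := by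
  have hs : Summable fun m : ℕ => |eulerCoeff p m| := by
    simpa using summable_abs_eulerCoeff hp0 hp1 1
  rw [eulerSeries, ← Real.norm_eq_abs]
  refine tsum_of_norm_bounded hs.hasSum fun m => ?_
  rw [Real.norm_eq_abs, abs_mul, abs_pow]
  exact mul_le_of_le_one_right (abs_nonneg _) (pow_le_one₀ (abs_nonneg _) hz)

/-- A zero at `α` would propagate to every `α p^m`, hence by continuity to `0`, where the series
equals `1`. -/
theorem eulerSeries_ne_zero {α : ℝ} (h0 : 0 < α) (h1 : α < 1) : eulerSeries p α ≠ 0 := by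
  intro h
  have hz : ∀ m : ℕ, eulerSeries p (α * p ^ m) = 0 := fun m => by
    rw [eulerSeries_eq_qPoch_mul hp0 hp1 α m] at h
    exact (mul_eq_zero.1 h).resolve_left (qPoch_pos h0.le h1 hp0 hp1 m).ne'
  have hlim : Tendsto (fun m : ℕ => α * p ^ m) atTop (𝓝 0) := by
    simpa using (tendsto_pow_atTop_nhds_zero_of_lt_one hp0.le hp1).const_mul α
  have hE : Tendsto (fun m : ℕ => eulerSeries p (α * p ^ m)) atTop
      (𝓝 (∑' k : ℕ, eulerCoeff p k * 0 ^ k)) := by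
    refine tendsto_tsum_of_dominated_convergence (bound := fun k => |eulerCoeff p k|)
      (by simpa using summable_abs_eulerCoeff hp0 hp1 1) (fun k => (hlim.pow k).const_mul _)
      (Eventually.of_forall fun m k => ?_)
    rw [Real.norm_eq_abs, abs_mul, abs_of_nonneg (a := (α * p ^ m) ^ k) (by positivity)]
    exact mul_le_of_le_one_right (abs_nonneg _) (pow_le_one₀ (by positivity)
      (mul_le_one₀ h1.le (by positivity) (pow_le_one₀ hp0.le hp1.le)))
  simp_rw [hz] at hE
  rw [tsum_eq_single 0 (by intro b hb; simp [hb])] at hE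
  have := tendsto_nhds_unique hE tendsto_const_nhds
  simp [eulerCoeff, qPoch] at this

end

/-! ### The Hahn-Exton function: recurrence, decay at infinity, behaviour at zero. -/

section

variable {α p : ℝ} (hα0 : 0 < α) (hα1 : α < 1) (hp0 : 0 < p) (hp1 : p < 1)
include hα0 hα1 hp0 hp1

theorem summable_abs_hahnExton (y : ℝ) :
    Summable fun m : ℕ => |eulerCoeff p m * (qPoch α p m)⁻¹ * (p * y) ^ m| := by
  refine Summable.of_nonneg_of_le (fun m => abs_nonneg _) (fun m => ?_)
    ((summable_abs_eulerCoeff hp0 hp1 (p * y)).mul_left (qPochInf α p)⁻¹)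
  rw [mul_right_comm, abs_mul, mul_comm, abs_inv, abs_of_pos (qPoch_pos hα0.le hα1 hp0 hp1 m)]
  gcongr
  · exact qPochInf_pos hα0.le hα1 hp0 hp1
  · exact qPochInf_le_qPoch hα0.le hα1 hp0 hp1 m

theorem summable_hahnExton (y : ℝ) :
    Summable fun m : ℕ => eulerCoeff p m * (qPoch α p m)⁻¹ * (p * y) ^ m :=
  (summable_abs_hahnExton hα0 hα1 hp0 hp1 y).of_abs

/-- On the `m`-th coefficient the three dilations give the factor `p + α p^{2m} - (p + α) p^m = p (1
- p^m)(1 - α p^{m-1})`. This cancels the last factors of `(p; p)_m` and `(α; p)_m`, so the series is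
shifted by one index. -/
theorem hahnExton_recurrence (y : ℝ) :
    p * hahnExton α p y + α * hahnExton α p (p * (p * y)) =
      (p + α - p ^ 2 * y) * hahnExton α p (p * y) := by
  have h0 := summable_hahnExton hα0 hα1 hp0 hp1 y
  have h1 := summable_hahnExton hα0 hα1 hp0 hp1 (p * y)
  have h2 := summable_hahnExton hα0 hα1 hp0 hp1 (p * (p * y))
  have hA := (h0.mul_left p).add (h2.mul_left α)
  have hB := h1.mul_left (p + α)
  have key : (p * hahnExton α p y + α * hahnExton α p (p * (p * y))) -
      (p + α) * hahnExton α p (p * y) = -(p ^ 2 * y) * hahnExton α p (p * y) := by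
    unfold hahnExton
    rw [← tsum_mul_left, ← tsum_mul_left, ← tsum_mul_left,
      ← (h0.mul_left p).tsum_add (h2.mul_left α), ← hA.tsum_sub hB,
      (hA.sub hB).tsum_eq_zero_add, ← tsum_mul_left]
    simp only [pow_zero]
    rw [show ∀ c : ℝ, p * (c * 1) + α * (c * 1) - (p + α) * (c * 1) = 0 by intro c; ring,
      zero_add]
    refine tsum_congr fun m => ?_
    have hc := eulerCoeff_succ hp0 hp1 m
    have hq : (qPoch α p (m + 1))⁻¹ * (1 - α * p ^ m) = (qPoch α p m)⁻¹ := by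
      have := (qPoch_pos hα0.le hα1 hp0 hp1 m).ne'
      have := (one_sub_mul_pow_pos hα0.le hα1 hp0 hp1 m).ne'
      rw [qPoch_succ]
      field_simp
    calc _ = p * (eulerCoeff p (m + 1) * (1 - p ^ (m + 1))) *
          ((qPoch α p (m + 1))⁻¹ * (1 - α * p ^ m)) * (p * y) ^ (m + 1) := by ring
      _ = _ := by rw [hc, hq]; ring
  linear_combination key

/-- Multiplying by Euler's series at `α` turns `1 / (α; p)_m` into Euler's series at `α p^m`.
Expanding it and exchanging the absolutely convergent sums leaves Euler's series in `y`, whose zeros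
are known. -/
theorem eulerSeries_mul_hahnExton (y : ℝ) :
    eulerSeries p α * hahnExton α p y =
      ∑' k : ℕ, eulerCoeff p k * α ^ k * eulerSeries p (p ^ k * (p * y)) := by
  have hF : Summable fun x : ℕ × ℕ =>
      eulerCoeff p x.1 * (p * y) ^ x.1 * (eulerCoeff p x.2 * (α * p ^ x.1) ^ x.2) := by
    refine Summable.of_norm_bounded ((summable_abs_eulerCoeff hp0 hp1 (p * y)).mul_of_nonneg
      (summable_abs_eulerCoeff hp0 hp1 α) (fun _ => abs_nonneg _) fun _ => abs_nonneg _)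
      fun x => ?_
    rw [norm_mul, Real.norm_eq_abs, Real.norm_eq_abs]
    refine mul_le_mul_of_nonneg_left ?_ (abs_nonneg _)
    rw [abs_mul, abs_mul]
    refine mul_le_mul_of_nonneg_left ?_ (abs_nonneg _)
    rw [abs_of_nonneg (by positivity), abs_of_nonneg (by positivity)]
    gcongr
    exact mul_le_of_le_one_right hα0.le (pow_le_one₀ hp0.le hp1.le)
  calc eulerSeries p α * hahnExton α p y
      = ∑' m : ℕ, ∑' k : ℕ,
          eulerCoeff p m * (p * y) ^ m * (eulerCoeff p k * (α * p ^ m) ^ k) := by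
        rw [hahnExton, ← tsum_mul_left]
        refine tsum_congr fun m => ?_
        rw [tsum_mul_left, ← eulerSeries, eulerSeries_eq_qPoch_mul hp0 hp1 α m]
        have := (qPoch_pos hα0.le hα1 hp0 hp1 m).ne'
        field_simp
    _ = ∑' k : ℕ, ∑' m : ℕ,
          eulerCoeff p m * (p * y) ^ m * (eulerCoeff p k * (α * p ^ m) ^ k) :=
        (Summable.tsum_comm (f := fun m k => eulerCoeff p m * (p * y) ^ m *
          (eulerCoeff p k * (α * p ^ m) ^ k)) hF).symm
    _ = _ := by
        refine tsum_congr fun k => ?_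
        rw [eulerSeries, ← tsum_mul_left]
        refine tsum_congr fun m => ?_
        rw [mul_pow α, mul_pow (p ^ k), ← pow_mul, ← pow_mul, mul_comm m k]
        ring

/-- At `y = p^{-N}` the terms `k < N` of `eulerSeries_mul_hahnExton` sit at zeros of Euler's series.
The remaining ones carry `eulerCoeff p k` with `k ≥ N`, of size at most a constant times
`p^{N(N-1)/2}`. -/
theorem exists_abs_hahnExton_zpow_neg_le : ∃ C : ℝ, ∀ N : ℕ,
    |hahnExton α p (p ^ (-(N : ℤ)))| ≤ C * p ^ N.choose 2 := by
  set M : ℝ := ∑' m : ℕ, |eulerCoeff p m| with hM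
  have hM0 : 0 ≤ M := tsum_nonneg fun _ => abs_nonneg _
  have hE := abs_pos.2 (eulerSeries_ne_zero hp0 hp1 hα0 hα1)
  have hd := qPochInf_pos hp0.le hp1 hp0 hp1
  refine ⟨|eulerSeries p α|⁻¹ * ((qPochInf p p)⁻¹ * M * (1 - α)⁻¹), fun N => ?_⟩
  have hb : |eulerSeries p α * hahnExton α p (p ^ (-(N : ℤ)))| ≤
      (qPochInf p p)⁻¹ * p ^ N.choose 2 * M * (1 - α)⁻¹ := by
    rw [eulerSeries_mul_hahnExton hα0 hα1 hp0 hp1, ← Real.norm_eq_abs]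
    refine tsum_of_norm_bounded ((hasSum_geometric_of_lt_one hα0.le hα1).mul_left _) fun k => ?_
    rw [Real.norm_eq_abs]
    have he : p ^ k * (p * p ^ (-(N : ℤ))) = p ^ ((k : ℤ) + 1 - N) := by
      rw [sub_eq_add_neg, zpow_add₀ hp0.ne', zpow_add_one₀ hp0.ne', zpow_natCast]; ring
    rw [he]
    rcases lt_or_ge k N with hk | hk
    · have : (k : ℤ) + 1 - N = -((N - 1 - k : ℕ) : ℤ) := by omega
      rw [this, eulerSeries_zpow_neg hp0 hp1]
      simp only [mul_zero, abs_zero]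
      have := sub_pos.2 hα1
      positivity
    · have h1 : |eulerSeries p (p ^ ((k : ℤ) + 1 - N))| ≤ M := by
        refine abs_eulerSeries_le hp0 hp1 ?_
        have : (k : ℤ) + 1 - N = ((k + 1 - N : ℕ) : ℤ) := by omega
        rw [this, zpow_natCast, abs_of_nonneg (by positivity)]
        exact pow_le_one₀ hp0.le hp1.le
      have h2 : |eulerCoeff p k| ≤ (qPochInf p p)⁻¹ * p ^ N.choose 2 :=
        (abs_eulerCoeff_le hp0 hp1 k).trans (mul_le_mul_of_nonneg_left
          (pow_le_pow_of_le_one hp0.le hp1.le (Nat.choose_mono 2 hk)) (inv_nonneg.2 hd.le))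
      rw [abs_mul, abs_mul, abs_of_nonneg (a := α ^ k) (by positivity)]
      calc |eulerCoeff p k| * α ^ k * |eulerSeries p (p ^ ((k : ℤ) + 1 - N))|
          ≤ (qPochInf p p)⁻¹ * p ^ N.choose 2 * α ^ k * M := by gcongr
        _ = _ := by ring
  rw [abs_mul] at hb
  rw [mul_assoc, ← div_eq_inv_mul, le_div_iff₀ hE]
  linarith

theorem exists_abs_hahnExton_sub_one_le : ∃ C : ℝ, 0 ≤ C ∧ ∀ y : ℝ, 0 ≤ y → y ≤ 1 →
    |hahnExton α p y - 1| ≤ C * y := by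
  refine ⟨∑' m : ℕ, |eulerCoeff p (m + 1) * (qPoch α p (m + 1))⁻¹ * (p * 1) ^ (m + 1)|,
    tsum_nonneg fun _ => abs_nonneg _, fun y hy0 hy1 => ?_⟩
  have h1 := (summable_nat_add_iff 1).2 (summable_abs_hahnExton hα0 hα1 hp0 hp1 1)
  have h2 : hahnExton α p y - 1 =
      ∑' m : ℕ, eulerCoeff p (m + 1) * (qPoch α p (m + 1))⁻¹ * (p * y) ^ (m + 1) := by
    rw [hahnExton, (summable_hahnExton hα0 hα1 hp0 hp1 y).tsum_eq_zero_add]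
    simp [eulerCoeff, qPoch]
  rw [h2, ← Real.norm_eq_abs]
  refine tsum_of_norm_bounded (h1.hasSum.mul_right y) fun m => ?_
  rw [Real.norm_eq_abs, mul_one, mul_pow, ← mul_assoc, abs_mul,
    abs_of_nonneg (a := y ^ (m + 1)) (by positivity)]
  refine mul_le_mul_of_nonneg_left ?_ (abs_nonneg _)
  exact pow_le_of_le_one hy0 hy1 (Nat.succ_ne_zero m)

end

/-! ### Lattice values of `j_v`: bounds and orthogonality of shifts. -/

/-- The values of `j_v` on the lattice: `latticeJ α p s` is the value at `z² = p^s`. -/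
def latticeJ (α p : ℝ) (s : ℤ) : ℝ := hahnExton α p (p ^ s)

theorem summable_int_of_le_geometric {f : ℤ → ℝ} {r C : ℝ} (hr0 : 0 ≤ r) (hr1 : r < 1)
    (hf : ∀ N : ℕ, |f N| ≤ C * r ^ N) (hf' : ∀ N : ℕ, |f (-N)| ≤ C * r ^ N) : Summable f := by
  have hg := (summable_geometric_of_lt_one hr0 hr1).mul_left C
  exact Summable.of_nat_of_neg (Summable.of_norm_bounded hg hf) (Summable.of_norm_bounded hg hf')

section

variable {α p : ℝ} (hα0 : 0 < α) (hα1 : α < 1) (hp0 : 0 < p) (hp1 : p < 1)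
include hα0 hα1 hp0 hp1

/-- Since `p^{N(N-1)/2} R^N` is bounded in `N`, any exponential rate `R` is allowed at `-∞`. Below,
`R = 1` gives boundedness and `R = α⁻¹` beats the growing weight `α^s`. -/
theorem exists_abs_latticeJ_le {R : ℝ} (hR : 1 ≤ R) :
    ∃ C : ℝ, 0 ≤ C ∧ ∀ s : ℤ, |latticeJ α p s| ≤ C * R ^ s := by
  obtain ⟨C₁, hC₁⟩ := exists_abs_hahnExton_zpow_neg_le hα0 hα1 hp0 hp1
  obtain ⟨C₂, hC₂0, hC₂⟩ := exists_abs_hahnExton_sub_one_le hα0 hα1 hp0 hp1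
  have hR0 : 0 < R := by linarith
  have hs := summable_pow_choose_two_mul_pow hp0 hp1 R
  set S := ∑' m : ℕ, p ^ m.choose 2 * R ^ m
  have hS0 : 0 ≤ S := tsum_nonneg fun m => by positivity
  refine ⟨|C₁| * S + (C₂ + 1), by positivity, fun s => ?_⟩
  obtain ⟨N, rfl | rfl⟩ := s.eq_nat_or_neg
  · have hy : (p : ℝ) ^ (N : ℤ) ≤ 1 := by
      rw [zpow_natCast]; exact pow_le_one₀ hp0.le hp1.le
    have h := hC₂ (p ^ (N : ℤ)) (by positivity) hy
    have h1 : |latticeJ α p N| ≤ C₂ + 1 := by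
      have h2 : C₂ * p ^ (N : ℤ) ≤ C₂ := mul_le_of_le_one_right hC₂0 hy
      have h3 := abs_add_le (hahnExton α p (p ^ (N : ℤ)) - 1) 1
      rw [sub_add_cancel, abs_one] at h3
      rw [latticeJ]
      linarith
    have h4 : (1 : ℝ) ≤ R ^ (N : ℤ) := by rw [zpow_natCast]; exact one_le_pow₀ hR
    calc |latticeJ α p N| ≤ (C₂ + 1) * 1 := by linarith
      _ ≤ (|C₁| * S + (C₂ + 1)) * R ^ (N : ℤ) := by
        have : 0 ≤ |C₁| * S := by positivity
        exact mul_le_mul (by linarith) h4 zero_le_one (by linarith)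
  · have h1 : p ^ N.choose 2 * R ^ N ≤ S := hs.le_tsum N fun m _ => by positivity
    calc |latticeJ α p (-N)| ≤ C₁ * p ^ N.choose 2 := hC₁ N
      _ ≤ |C₁| * p ^ N.choose 2 := by gcongr; exact le_abs_self _
      _ = |C₁| * (p ^ N.choose 2 * R ^ N) * R ^ (-(N : ℤ)) := by
        rw [zpow_neg, zpow_natCast]; field_simp
      _ ≤ (|C₁| * S + (C₂ + 1)) * R ^ (-(N : ℤ)) := by
        gcongr
        have : |C₁| * (p ^ N.choose 2 * R ^ N) ≤ |C₁| * S := by gcongr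
        linarith

theorem exists_abs_latticeJ_le_const : ∃ M : ℝ, 0 ≤ M ∧ ∀ s : ℤ, |latticeJ α p s| ≤ M := by
  simpa using exists_abs_latticeJ_le hα0 hα1 hp0 hp1 le_rfl

theorem exists_abs_latticeJ_sub_one_le :
    ∃ C : ℝ, 0 ≤ C ∧ ∀ s : ℤ, |latticeJ α p s - 1| ≤ C * p ^ s := by
  obtain ⟨M, hM0, hM⟩ := exists_abs_latticeJ_le_const hα0 hα1 hp0 hp1
  obtain ⟨C, hC0, hC⟩ := exists_abs_hahnExton_sub_one_le hα0 hα1 hp0 hp1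
  refine ⟨C + (M + 1), by positivity, fun s => ?_⟩
  have hps : 0 < p ^ s := by positivity
  rcases le_total (p ^ s) 1 with h | h
  · refine (hC _ hps.le h).trans ?_
    gcongr
    linarith
  · have h1 := abs_sub (latticeJ α p s) 1
    rw [abs_one] at h1
    have h2 := hM s
    nlinarith

theorem tendsto_latticeJ (m : ℤ) :
    Tendsto (fun N : ℕ => latticeJ α p (m + N)) atTop (𝓝 1) := by
  obtain ⟨C, hC0, hC⟩ := exists_abs_latticeJ_sub_one_le hα0 hα1 hp0 hp1
  rw [tendsto_iff_norm_sub_tendsto_zero]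
  refine squeeze_zero (fun N => norm_nonneg _) (fun N => hC (m + N)) ?_
  have h := (tendsto_pow_atTop_nhds_zero_of_lt_one hp0.le hp1).const_mul (C * p ^ m)
  rw [mul_zero] at h
  refine h.congr fun N => ?_
  rw [zpow_add₀ hp0.ne', zpow_natCast, mul_assoc]

theorem latticeJ_recurrence (s : ℤ) :
    p * latticeJ α p (s - 1) + α * latticeJ α p (s + 1) =
      (p + α - p * p ^ s) * latticeJ α p s := by
  have h := hahnExton_recurrence hα0 hα1 hp0 hp1 (p ^ (s - 1))
  have h1 : p * p ^ (s - 1) = p ^ s := by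
    rw [← zpow_one_add₀ hp0.ne']; congr 1; ring
  rw [pow_two, mul_assoc p p, h1, ← zpow_one_add₀ hp0.ne', add_comm 1 s] at h
  rw [← zpow_one_add₀ hp0.ne', add_comm 1 s]
  exact h

theorem summable_zpow_mul_latticeJ_mul_latticeJ (k l : ℤ) :
    Summable fun s : ℤ => α ^ s * (latticeJ α p (s + k) * latticeJ α p (s + l)) := by
  obtain ⟨M, hM0, hM⟩ := exists_abs_latticeJ_le_const hα0 hα1 hp0 hp1
  obtain ⟨C, hC0, hC⟩ := exists_abs_latticeJ_le hα0 hα1 hp0 hp1 (one_le_inv_iff₀.2 ⟨hα0, hα1.le⟩)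
  refine summable_int_of_le_geometric (r := α) (C := M * M + C * α⁻¹ ^ k * (C * α⁻¹ ^ l))
    hα0.le hα1 (fun N => ?_) fun N => ?_
  · rw [abs_mul, abs_mul, zpow_natCast, abs_of_nonneg (by positivity), mul_comm]
    gcongr
    have : |latticeJ α p (N + k)| * |latticeJ α p (N + l)| ≤ M * M := by
      gcongr <;> exact hM _
    have : 0 ≤ C * α⁻¹ ^ k * (C * α⁻¹ ^ l) := by positivity
    linarith
  · rw [abs_mul, abs_mul, abs_of_nonneg (by positivity)]
    calc α ^ (-(N : ℤ)) * (|latticeJ α p (-N + k)| * |latticeJ α p (-N + l)|)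
        ≤ α ^ (-(N : ℤ)) * (C * α⁻¹ ^ (-(N : ℤ) + k) * (C * α⁻¹ ^ (-(N : ℤ) + l))) := by
          gcongr <;> exact hC _
      _ = (C * α⁻¹ ^ k * (C * α⁻¹ ^ l)) * α ^ N := by
          rw [zpow_add₀ (inv_ne_zero hα0.ne'), zpow_add₀ (inv_ne_zero hα0.ne'), zpow_neg,
            zpow_neg, inv_zpow, zpow_natCast, inv_inv]
          field_simp
      _ ≤ _ := by
          gcongr
          have : 0 ≤ M * M := by positivity
          linarith

/-- The weighted Casoratian of two shifts of `latticeJ` is summable over `ℤ`. -/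
theorem summable_casoratian (k l : ℤ) : Summable fun s : ℤ => (α / p) ^ s *
    (latticeJ α p (s - 1 + k) * latticeJ α p (s + l) -
      latticeJ α p (s - 1 + l) * latticeJ α p (s + k)) := by
  obtain ⟨M, hM0, hM⟩ := exists_abs_latticeJ_le_const hα0 hα1 hp0 hp1
  obtain ⟨B, hB0, hB⟩ := exists_abs_latticeJ_sub_one_le hα0 hα1 hp0 hp1
  obtain ⟨C, hC0, hC⟩ := exists_abs_latticeJ_le hα0 hα1 hp0 hp1 (one_le_inv_iff₀.2 ⟨hα0, hα1.le⟩)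
  have hap : α / p ≠ 0 := (div_pos hα0 hp0).ne'
  have hi : α⁻¹ ≠ 0 := inv_ne_zero hα0.ne'
  set K₁ := B * p ^ (-1 + k) * M + B * p ^ l + (B * p ^ (-1 + l) * M + B * p ^ k)
  set K₂ := C * α⁻¹ ^ (-1 + k) * (C * α⁻¹ ^ l) + C * α⁻¹ ^ (-1 + l) * (C * α⁻¹ ^ k)
  have hK₁ : 0 ≤ K₁ := by positivity
  have hK₂ : 0 ≤ K₂ := by positivity
  refine summable_int_of_le_geometric (r := α) (C := K₁ + K₂) hα0.le hα1 (fun N => ?_) fun N => ?_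
  · rw [abs_mul, abs_of_nonneg (by positivity)]
    -- Towards `+∞` both products tend to `1` with error `O(p^N)`. Their difference therefore
    -- absorbs the `p^{-N}` of the weight and leaves `α^N`.
    have hJ : ∀ m m' : ℤ, |latticeJ α p (N + m) * latticeJ α p (N + m') - 1| ≤
        (B * p ^ m * M + B * p ^ m') * p ^ N := by
      intro m m'
      have h1 := hB (N + m)
      have h2 := hB (N + m')
      rw [zpow_add₀ hp0.ne', zpow_natCast] at h1 h2
      calc |latticeJ α p (N + m) * latticeJ α p (N + m') - 1|
          = |(latticeJ α p (N + m) - 1) * latticeJ α p (N + m') +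
              (latticeJ α p (N + m') - 1)| := by congr 1; ring
        _ ≤ |latticeJ α p (N + m) - 1| * |latticeJ α p (N + m')| +
              |latticeJ α p (N + m') - 1| := (abs_add_le _ _).trans (by rw [abs_mul])
        _ ≤ B * (p ^ N * p ^ m) * M + B * (p ^ N * p ^ m') := by
          gcongr; exact hM _
        _ = _ := by ring
    have h1 := hJ (-1 + k) l
    have h2 := hJ (-1 + l) k
    simp only [← add_assoc, ← sub_eq_add_neg] at h1 h2
    have h3 := abs_sub_le (latticeJ α p (N - 1 + k) * latticeJ α p (N + l)) 1
      (latticeJ α p (N - 1 + l) * latticeJ α p (N + k))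
    rw [abs_sub_comm 1] at h3
    have h4 : |latticeJ α p (N - 1 + k) * latticeJ α p (N + l) -
        latticeJ α p (N - 1 + l) * latticeJ α p (N + k)| ≤ K₁ * p ^ N := by
      refine h3.trans ((add_le_add h1 h2).trans (le_of_eq ?_))
      simp only [K₁]; ring
    calc _ ≤ (α / p) ^ (N : ℤ) * (K₁ * p ^ N) := by gcongr
      _ = K₁ * α ^ N := by rw [zpow_natCast, div_pow]; field_simp
      _ ≤ _ := by gcongr; linarith
  · rw [abs_mul, abs_of_nonneg (by positivity)]
    -- Towards `-∞` each factor is `O(α^N)`, against the weight `(p/α)^N`.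
    have h1 : ∀ m m' : ℤ, |latticeJ α p (-N + m) * latticeJ α p (-N + m')| ≤
        C * α⁻¹ ^ m * (C * α⁻¹ ^ m') * (α ^ N * α ^ N) := by
      intro m m'
      rw [abs_mul]
      calc _ ≤ C * α⁻¹ ^ (-(N : ℤ) + m) * (C * α⁻¹ ^ (-(N : ℤ) + m')) := by
            gcongr <;> exact hC _
        _ = _ := by
            rw [zpow_add₀ hi, zpow_add₀ hi, inv_zpow _ (-(N : ℤ)), zpow_neg, inv_inv,
              zpow_natCast]
            ring
    have h2 : |latticeJ α p (-N - 1 + k) * latticeJ α p (-N + l) -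
        latticeJ α p (-N - 1 + l) * latticeJ α p (-N + k)| ≤ K₂ * (α ^ N * α ^ N) := by
      have h3 := h1 (-1 + k) l
      have h4 := h1 (-1 + l) k
      simp only [← add_assoc, ← sub_eq_add_neg] at h3 h4
      refine (abs_sub _ _).trans ((add_le_add h3 h4).trans (le_of_eq ?_))
      simp only [K₂]; ring
    calc _ ≤ (α / p) ^ (-(N : ℤ)) * (K₂ * (α ^ N * α ^ N)) := by gcongr
      _ = K₂ * α ^ N * p ^ N := by
        rw [zpow_neg, zpow_natCast, div_pow]; field_simp
      _ ≤ K₂ * α ^ N * 1 := by gcongr; exact pow_le_one₀ hp0.le hp1.le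
      _ ≤ _ := by rw [mul_one]; gcongr; linarith

/-- Discrete Lagrange identity: the recurrences at `s + k` and `s + l`, cross-multiplied, show that
the Casoratian `W` has increment `(p^k - p^l)` times the summand. As `W` is summable over `ℤ`, its
increments sum to zero, and `p^k ≠ p^l`. -/
theorem tsum_zpow_mul_latticeJ_mul_latticeJ_of_ne {k l : ℤ} (hkl : k ≠ l) :
    ∑' s : ℤ, α ^ s * (latticeJ α p (s + k) * latticeJ α p (s + l)) = 0 := by
  have hw := summable_casoratian hα0 hα1 hp0 hp1 k l
  set W : ℤ → ℝ := fun s => (α / p) ^ s *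
    (latticeJ α p (s - 1 + k) * latticeJ α p (s + l) -
      latticeJ α p (s - 1 + l) * latticeJ α p (s + k)) with hW
  have hw' : Summable fun s : ℤ => W (s + 1) := (Equiv.addRight (1 : ℤ)).summable_iff.2 hw
  have hshift : ∑' s : ℤ, W (s + 1) = ∑' s : ℤ, W s := (Equiv.addRight (1 : ℤ)).tsum_eq W
  have hstep : ∀ s : ℤ, W (s + 1) - W s =
      (p ^ k - p ^ l) * (α ^ s * (latticeJ α p (s + k) * latticeJ α p (s + l))) := by
    intro s
    set r := α / p with hr
    have hα : α = r * p := by rw [hr]; field_simp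
    have hrec : ∀ m : ℤ, latticeJ α p (s + m - 1) + r * latticeJ α p (s + m + 1) =
        (1 + r - p ^ s * p ^ m) * latticeJ α p (s + m) := by
      intro m
      have h := latticeJ_recurrence hα0 hα1 hp0 hp1 (s + m)
      rw [zpow_add₀ hp0.ne'] at h
      refine mul_left_cancel₀ hp0.ne' ?_
      have e : α * latticeJ α p (s + m + 1) = r * p * latticeJ α p (s + m + 1) := by rw [← hα]
      linear_combination h - e + latticeJ α p (s + m) * hα
    have e1 : s + 1 - 1 = s := by ring
    have e2 : ∀ m : ℤ, s + 1 + m = s + m + 1 := fun m => by ring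
    have e3 : ∀ m : ℤ, s - 1 + m = s + m - 1 := fun m => by ring
    have e4 : α ^ s = r ^ s * p ^ s := by rw [← mul_zpow, ← hα]
    have hr0 : r ≠ 0 := (div_pos hα0 hp0).ne'
    rw [e4]
    simp only [hW, e1, e2, e3, zpow_add_one₀ hr0]
    linear_combination r ^ s * (latticeJ α p (s + k) * hrec l - latticeJ α p (s + l) * hrec k)
  have h0 : (p ^ k - p ^ l) *
      ∑' s : ℤ, α ^ s * (latticeJ α p (s + k) * latticeJ α p (s + l)) = 0 := by
    rw [← tsum_mul_left, ← tsum_congr hstep, hw'.tsum_sub hw, hshift, sub_self]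
  refine (mul_eq_zero.1 h0).resolve_left (sub_ne_zero.2 fun h => hkl ?_)
  exact zpow_right_injective₀ hp0 hp1.ne h

omit hα1 hp0 hp1 in
theorem tsum_zpow_mul_latticeJ_sq (k : ℤ) :
    α ^ k * ∑' s : ℤ, α ^ s * (latticeJ α p (s + k) * latticeJ α p (s + k)) =
      ∑' s : ℤ, α ^ s * (latticeJ α p s * latticeJ α p s) := by
  rw [← tsum_mul_left, ← (Equiv.addRight k).tsum_eq
    (fun s => α ^ s * (latticeJ α p s * latticeJ α p s))]
  refine tsum_congr fun s => ?_
  rw [Equiv.coe_addRight, zpow_add₀ hα0.ne']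
  ring

theorem tsum_zpow_mul_latticeJ_sq_pos :
    0 < ∑' s : ℤ, α ^ s * (latticeJ α p s * latticeJ α p s) := by
  have hs := summable_zpow_mul_latticeJ_mul_latticeJ hα0 hα1 hp0 hp1 0 0
  simp only [add_zero] at hs
  have h1 := tendsto_latticeJ hα0 hα1 hp0 hp1 0
  obtain ⟨N, hN⟩ := (h1.eventually_ne one_ne_zero).exists
  refine hs.tsum_pos (fun s => mul_nonneg (by positivity) (mul_self_nonneg _)) (0 + N) ?_
  exact mul_pos (by positivity) (mul_self_pos.2 hN)

end

/-! ### Jackson's integrals as weighted sums; the two spaces as `ℓ²` spaces. -/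

/-- The base `α = q^{2v+2}` of the weight of `x^{2v+1} d_q x` at `x = q^s`. -/
def weightBase (q : Set.Ioo (0 : ℝ) 1) (v : ℝ) : ℝ := (q : ℝ) ^ (2 * v + 2)

theorem weightBase_pos (q : Set.Ioo (0 : ℝ) 1) (v : ℝ) : 0 < weightBase q v :=
  Real.rpow_pos_of_pos q.2.1 _

theorem weightBase_lt_one (q : Set.Ioo (0 : ℝ) 1) {v : ℝ} (hv : -1 < v) : weightBase q v < 1 :=
  Real.rpow_lt_one q.2.1.le q.2.2 (by linarith)

theorem base_sq_pos (q : Set.Ioo (0 : ℝ) 1) : 0 < (q : ℝ) ^ 2 := pow_pos q.2.1 2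

theorem base_sq_lt_one (q : Set.Ioo (0 : ℝ) 1) : (q : ℝ) ^ 2 < 1 :=
  pow_lt_one₀ q.2.1.le q.2.2 two_ne_zero

theorem coe_RqNode (q : Set.Ioo (0 : ℝ) 1) (s : ℤ) : (RqNode q s : ℝ) = (q : ℝ) ^ s := rfl

theorem coe_qIntervalNode (q : Set.Ioo (0 : ℝ) 1) (n : ℤ) (k : ℕ) :
    (qIntervalNode q n k : ℝ) = (q : ℝ) ^ (n + k) := by
  rw [zpow_add₀ q.2.1.ne', zpow_natCast]; rfl

theorem wIoi_eq (q : Set.Ioo (0 : ℝ) 1) (v : ℝ) (s : ℤ) : wIoi q v s = weightBase q v ^ s := by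
  have hq := q.2.1
  rw [wIoi, coe_RqNode, weightBase, ← Real.rpow_intCast, ← Real.rpow_intCast, ← Real.rpow_mul hq.le,
    ← Real.rpow_mul hq.le, ← Real.rpow_add hq]
  congr 1; ring

theorem wIcc_eq (q : Set.Ioo (0 : ℝ) 1) (v : ℝ) (n : ℤ) (k : ℕ) :
    (q : ℝ) ^ n * wIcc q v n k = weightBase q v ^ (n + k) := by
  rw [← wIoi_eq, wIoi, wIcc, coe_RqNode, coe_qIntervalNode, ← mul_assoc, zpow_add₀ q.2.1.ne',
    zpow_natCast]

/-- The mass `(1 - q) α^s` of the point `q^s` for `x^{2v+1} d_q x`. -/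
def mass (q : Set.Ioo (0 : ℝ) 1) (v : ℝ) (s : ℤ) : ℝ := (1 - (q : ℝ)) * weightBase q v ^ s

theorem mass_pos (q : Set.Ioo (0 : ℝ) 1) (v : ℝ) (s : ℤ) : 0 < mass q v s :=
  mul_pos (sub_pos.2 q.2.2) (zpow_pos (weightBase_pos q v) s)

theorem besselJ_node (q : Set.Ioo (0 : ℝ) 1) (v : ℝ) (n s : ℤ) (k : ℕ) :
    besselJ v ((RqNode q s : ℝ) * (qIntervalNode q n k : ℝ)) ((q : ℝ) ^ 2) =
      latticeJ (weightBase q v) ((q : ℝ) ^ 2) (s + (n + k)) := by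
  have hq := q.2.1
  rw [besselJ_eq_hahnExton, latticeJ, weightBase, coe_RqNode, coe_qIntervalNode]
  congr 1
  · rw [← Real.rpow_natCast, ← Real.rpow_mul hq.le]
    congr 1; push_cast; ring
  · rw [← zpow_add₀ hq.ne', ← zpow_natCast, ← zpow_mul, ← zpow_natCast, ← zpow_mul, mul_comm]

theorem besselJ_neg (v z p : ℝ) : besselJ v (-z) p = besselJ v z p := by
  simp only [besselJ_eq_hahnExton, neg_sq]

theorem exists_eq_qIntervalNode {q : Set.Ioo (0 : ℝ) 1} {n : ℤ} (x : qInterval q n) :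
    ∃ k : ℕ, x = qIntervalNode q n k := by
  obtain ⟨x, s, hs, rfl⟩ := x
  obtain ⟨k, rfl⟩ := Int.le.dest hs
  exact ⟨k, Subtype.ext (coe_qIntervalNode q n k).symm⟩

theorem qIntervalNode_injective (q : Set.Ioo (0 : ℝ) 1) (n : ℤ) :
    Function.Injective (qIntervalNode q n) := by
  intro k l h
  have h1 : (q : ℝ) ^ n * (q : ℝ) ^ k = (q : ℝ) ^ n * (q : ℝ) ^ l := congrArg Subtype.val h
  exact pow_right_injective₀ q.2.1 q.2.2.ne (mul_left_cancel₀ (zpow_ne_zero n q.2.1.ne') h1)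

theorem exists_abs_eq_RqNode {q : Set.Ioo (0 : ℝ) 1} (x : Rq q) :
    ∃ s : ℤ, |(x : ℝ)| = RqNode q s := by
  obtain ⟨x, s, rfl | rfl⟩ := x
  · exact ⟨s, abs_of_pos (zpow_pos q.2.1 s)⟩
  · exact ⟨s, by rw [abs_neg, abs_of_pos (zpow_pos q.2.1 s), coe_RqNode]⟩

theorem RqNode_injective (q : Set.Ioo (0 : ℝ) 1) :
    Function.Injective fun s => (RqNode q s : ℝ) :=
  zpow_right_injective₀ q.2.1 q.2.2.ne

theorem even_eq_RqNode {q : Set.Ioo (0 : ℝ) 1} {f : Rq q → ℝ}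
    (hf : ∀ x y : Rq q, (x : ℝ) = -(y : ℝ) → f x = f y) {x : Rq q} {s : ℤ}
    (hx : |(x : ℝ)| = RqNode q s) : f x = f (RqNode q s) := by
  rcases abs_eq_abs.1 (hx.trans (abs_of_pos (zpow_pos q.2.1 s)).symm) with h | h
  · exact congrArg f (Subtype.ext h)
  · exact hf _ _ h

variable {q : Set.Ioo (0 : ℝ) 1} {v : ℝ} {n : ℤ}

theorem jacksonIcc_eq (f : qInterval q n → ℝ) :
    jacksonIcc q n (fun t => f t * (t : ℝ) ^ (2 * v + 1)) =
      ∑' k : ℕ, mass q v (n + k) * f (qIntervalNode q n k) := by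
  rw [jacksonIcc, ← tsum_mul_left]
  refine tsum_congr fun k => ?_
  rw [mass, ← wIcc_eq, wIcc]
  ring

theorem jacksonIoi_eq (f : Rq q → ℝ) :
    jacksonIoi q (fun t => f t * (t : ℝ) ^ (2 * v + 1)) =
      ∑' s : ℤ, mass q v s * f (RqNode q s) := by
  rw [jacksonIoi, ← tsum_mul_left]
  refine tsum_congr fun s => ?_
  rw [mass, ← wIoi_eq, wIoi]
  ring

theorem inner_LIcc (f g : LIcc q v n) : inner ℝ f g =
    ∑' k : ℕ, mass q v (n + k) * (f (qIntervalNode q n k) * g (qIntervalNode q n k)) :=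
  jacksonIcc_eq fun t => f t * g t

theorem inner_LIoi (f g : LIoi q v) : inner ℝ f g =
    ∑' s : ℤ, mass q v s * (f (RqNode q s) * g (RqNode q s)) :=
  jacksonIoi_eq fun t => f t * g t

theorem besselInt_eq (u : LIcc q v n) (x : ℝ) : besselInt u x =
    ∑' k : ℕ, mass q v (n + k) *
      (u (qIntervalNode q n k) * besselJ v (x * qIntervalNode q n k) ((q : ℝ) ^ 2)) :=
  jacksonIcc_eq fun t => u t * besselJ v (x * t) ((q : ℝ) ^ 2)

theorem mem_subIcc_iff {f : qInterval q n → ℝ} : f ∈ subIcc q v n ↔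
    Summable fun k : ℕ => mass q v (n + k) * f (qIntervalNode q n k) ^ 2 := by
  change (Summable _) ↔ _
  rw [← summable_mul_left_iff (mul_pos (sub_pos.2 q.2.2) (zpow_pos q.2.1 n)).ne']
  refine summable_congr fun k => ?_
  rw [mass, ← wIcc_eq]
  ring

theorem mem_subIoi_iff {f : Rq q → ℝ} : f ∈ subIoi q v ↔
    (∀ x y : Rq q, (x : ℝ) = -(y : ℝ) → f x = f y) ∧
      Summable fun s : ℤ => mass q v s * f (RqNode q s) ^ 2 := by
  change (_ ∧ Summable _) ↔ _
  rw [← summable_mul_left_iff (sub_pos.2 q.2.2).ne']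
  refine and_congr_right fun _ => summable_congr fun k => ?_
  rw [mass, ← wIoi_eq]
  ring

theorem LIcc_ext {f g : LIcc q v n} (h : ∀ k, f (qIntervalNode q n k) = g (qIntervalNode q n k)) :
    f = g := by
  refine Subtype.ext (funext fun x => ?_)
  obtain ⟨k, rfl⟩ := exists_eq_qIntervalNode x
  exact h k

theorem memℓp_two_of_summable {ι : Type*} {w f : ι → ℝ} (hw : ∀ i, 0 ≤ w i)
    (hf : Summable fun i => w i * f i ^ 2) : Memℓp (fun i => √(w i) * f i) 2 := by
  refine memℓp_gen ?_
  refine hf.congr fun i => ?_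
  simp [mul_pow, Real.sq_sqrt (hw i)]

theorem summable_of_lp_two {ι : Type*} (f : lp (fun _ : ι => ℝ) 2) :
    Summable fun i => f i ^ 2 := by
  have := (lp.memℓp f).summable (by norm_num)
  simpa using this

/-- Square integrable functions on `[0, a]_q` as square summable sequences. -/
def isometryIcc (q : Set.Ioo (0 : ℝ) 1) (v : ℝ) (n : ℤ) :
    LIcc q v n →ₗᵢ[ℝ] lp (fun _ : ℕ => ℝ) 2 :=
  LinearMap.isometryOfInner
    { toFun := fun u => ⟨fun k => √(mass q v (n + k)) * u (qIntervalNode q n k),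
        memℓp_two_of_summable (fun k => (mass_pos q v (n + k)).le) (mem_subIcc_iff.1 u.2)⟩
      map_add' := fun f g => lp.ext (funext fun k => mul_add _ _ _)
      map_smul' := fun c f => lp.ext (funext fun k => mul_left_comm _ _ _) }
    fun f g => by
      rw [lp.inner_eq_tsum, inner_LIcc]
      refine tsum_congr fun k => ?_
      have := Real.mul_self_sqrt (mass_pos q v (n + k)).le
      change √(mass q v (n + k)) * g (qIntervalNode q n k) *
        (√(mass q v (n + k)) * f (qIntervalNode q n k)) = _
      linear_combination (f (qIntervalNode q n k) * g (qIntervalNode q n k)) * this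

/-- Square integrable even functions on `ℝ_q` as square summable families. -/
def isometryIoi (q : Set.Ioo (0 : ℝ) 1) (v : ℝ) : LIoi q v →ₗᵢ[ℝ] lp (fun _ : ℤ => ℝ) 2 :=
  LinearMap.isometryOfInner
    { toFun := fun u => ⟨fun s => √(mass q v s) * u (RqNode q s),
        memℓp_two_of_summable (fun s => (mass_pos q v s).le) (mem_subIoi_iff.1 u.2).2⟩
      map_add' := fun f g => lp.ext (funext fun s => mul_add _ _ _)
      map_smul' := fun c f => lp.ext (funext fun s => mul_left_comm _ _ _) }
    fun f g => by
      rw [lp.inner_eq_tsum, inner_LIoi]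
      refine tsum_congr fun s => ?_
      have := Real.mul_self_sqrt (mass_pos q v s).le
      change √(mass q v s) * g (RqNode q s) * (√(mass q v s) * f (RqNode q s)) = _
      linear_combination (f (RqNode q s) * g (RqNode q s)) * this

theorem isometryIcc_surjective : Function.Surjective (isometryIcc q v n) := by
  intro f
  choose k hk using fun x : qInterval q n => exists_eq_qIntervalNode x
  have hkn : ∀ m, k (qIntervalNode q n m) = m := fun m =>
    qIntervalNode_injective q n (hk _).symm
  have hm : ∀ m : ℕ, √(mass q v (n + m)) ≠ 0 := fun m => (Real.sqrt_pos.2 (mass_pos q v _)).ne'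
  refine ⟨⟨fun x => (√(mass q v (n + k x)))⁻¹ * f (k x), mem_subIcc_iff.2 ?_⟩, ?_⟩
  · refine (summable_of_lp_two f).congr fun m => ?_
    have := Real.sq_sqrt (mass_pos q v (n + m)).le
    rw [hkn, mul_pow, inv_pow, this, mul_inv_cancel_left₀ (mass_pos q v _).ne']
  · refine lp.ext (funext fun m => ?_)
    change √(mass q v (n + m)) * ((√(mass q v (n + k (qIntervalNode q n m))))⁻¹ *
      f (k (qIntervalNode q n m))) = f m
    rw [hkn, mul_inv_cancel_left₀ (hm m)]

theorem isometryIoi_surjective : Function.Surjective (isometryIoi q v) := by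
  intro f
  choose k hk using fun x : Rq q => exists_abs_eq_RqNode x
  have hkn : ∀ s, k (RqNode q s) = s := fun s => by
    refine RqNode_injective q ?_
    change (RqNode q (k (RqNode q s)) : ℝ) = RqNode q s
    rw [← hk, coe_RqNode, abs_of_pos (zpow_pos q.2.1 s)]
  have hm : ∀ s : ℤ, √(mass q v s) ≠ 0 := fun s => (Real.sqrt_pos.2 (mass_pos q v _)).ne'
  refine ⟨⟨fun x => (√(mass q v (k x)))⁻¹ * f (k x), mem_subIoi_iff.2 ⟨?_, ?_⟩⟩, ?_⟩
  · intro x y hxy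
    have : k x = k y := RqNode_injective q (by
      change (RqNode q (k x) : ℝ) = RqNode q (k y)
      rw [← hk, ← hk, hxy, abs_neg])
    rw [this]
  · refine (summable_of_lp_two f).congr fun m => ?_
    have := Real.sq_sqrt (mass_pos q v m).le
    rw [hkn, mul_pow, inv_pow, this, mul_inv_cancel_left₀ (mass_pos q v _).ne']
  · refine lp.ext (funext fun m => ?_)
    change √(mass q v m) * ((√(mass q v (k (RqNode q m))))⁻¹ * f (k (RqNode q m))) = f m
    rw [hkn, mul_inv_cancel_left₀ (hm m)]

/-- The Hilbert basis of `L_{q,v,a}` of normalized point masses. -/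
def deltaIcc (q : Set.Ioo (0 : ℝ) 1) (v : ℝ) (n : ℤ) : HilbertBasis ℕ ℝ (LIcc q v n) :=
  HilbertBasis.ofRepr (LinearIsometryEquiv.ofSurjective _ isometryIcc_surjective)

/-- The Hilbert basis of `L_{q,2,v}` of normalized pairs of point masses. -/
def deltaIoi (q : Set.Ioo (0 : ℝ) 1) (v : ℝ) : HilbertBasis ℤ ℝ (LIoi q v) :=
  HilbertBasis.ofRepr (LinearIsometryEquiv.ofSurjective _ isometryIoi_surjective)

theorem deltaIcc_repr (u : LIcc q v n) (k : ℕ) :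
    (deltaIcc q v n).repr u k = √(mass q v (n + k)) * u (qIntervalNode q n k) := rfl

theorem deltaIoi_repr (u : LIoi q v) (s : ℤ) :
    (deltaIoi q v).repr u s = √(mass q v s) * u (RqNode q s) := rfl

instance : CompleteSpace (LIcc q v n) :=
  (deltaIcc q v n).repr.toIsometryEquiv.completeSpace

instance : CompleteSpace (LIoi q v) :=
  (deltaIoi q v).repr.toIsometryEquiv.completeSpace

/-- Evaluation at a point of `[0, a]_q`. -/
def evalIcc (v : ℝ) (n : ℤ) (k : ℕ) : LIcc q v n →L[ℝ] ℝ :=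
  (√(mass q v (n + k)))⁻¹ • innerSL ℝ (deltaIcc q v n k)

theorem evalIcc_apply (k : ℕ) (u : LIcc q v n) :
    evalIcc v n k u = u (qIntervalNode q n k) := by
  change (√(mass q v (n + k)))⁻¹ * inner ℝ (deltaIcc q v n k) u = _
  rw [← HilbertBasis.repr_apply_apply, deltaIcc_repr,
    inv_mul_cancel_left₀ (Real.sqrt_pos.2 (mass_pos q v _)).ne']

theorem norm_evalIcc_le (k : ℕ) :
    ‖(evalIcc v n k : LIcc q v n →L[ℝ] ℝ)‖ ≤ (√(mass q v (n + k)))⁻¹ := by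
  refine ContinuousLinearMap.opNorm_le_bound _ (by positivity) fun u => ?_
  change ‖(√(mass q v (n + k)))⁻¹ * inner ℝ (deltaIcc q v n k) u‖ ≤ _
  rw [norm_mul, norm_inv, Real.norm_of_nonneg (Real.sqrt_nonneg _)]
  refine mul_le_mul_of_nonneg_left ?_ (by positivity)
  simpa [(deltaIcc q v n).orthonormal.1] using norm_inner_le_norm (𝕜 := ℝ) (deltaIcc q v n k) u

/-- Evaluation at a positive point of `ℝ_q`. -/
def evalIoi (v : ℝ) (s : ℤ) : LIoi q v →L[ℝ] ℝ :=
  (√(mass q v s))⁻¹ • innerSL ℝ (deltaIoi q v s)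

theorem evalIoi_apply (s : ℤ) (u : LIoi q v) : evalIoi v s u = u (RqNode q s) := by
  change (√(mass q v s))⁻¹ * inner ℝ (deltaIoi q v s) u = _
  rw [← HilbertBasis.repr_apply_apply, deltaIoi_repr,
    inv_mul_cancel_left₀ (Real.sqrt_pos.2 (mass_pos q v _)).ne']

/-! ### The kernels on `ℝ_q` and the isometric transform. -/

theorem besselInt_neg (u : LIcc q v n) (x : ℝ) : besselInt u (-x) = besselInt u x := by
  simp only [besselInt_eq, neg_mul, besselJ_neg]

section

variable (hv : -1 < v)

/-- The kernel `x ↦ j_v(xt, q²)` on `ℝ_q`, for `t = a q^k`. -/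
def kernelIoi (hv : -1 < v) (n : ℤ) (k : ℕ) : LIoi q v :=
  ⟨fun x => besselJ v (x * qIntervalNode q n k) ((q : ℝ) ^ 2), mem_subIoi_iff.2
    ⟨fun x y h => by rw [h, neg_mul, besselJ_neg], by
      refine ((summable_zpow_mul_latticeJ_mul_latticeJ (weightBase_pos q v)
        (weightBase_lt_one q hv) (base_sq_pos q) (base_sq_lt_one q) (n + k) (n + k)).mul_left
        (1 - (q : ℝ))).congr fun s => ?_
      rw [besselJ_node, mass]
      ring⟩⟩

include hv in
theorem summable_mass (n : ℤ) : Summable fun k : ℕ => mass q v (n + k) := by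
  refine ((summable_geometric_of_lt_one (weightBase_pos q v).le
    (weightBase_lt_one q hv)).mul_left (mass q v n)).congr fun k => ?_
  rw [mass, mass, zpow_add₀ (weightBase_pos q v).ne', zpow_natCast, mul_assoc]

theorem kernelIoi_apply (k : ℕ) (s : ℤ) : kernelIoi hv n k (RqNode q s) =
    latticeJ (weightBase q v) ((q : ℝ) ^ 2) (s + (n + k)) := besselJ_node q v n s k

/-- The square of the norm of the transform `u ↦ ∫ u(t) j_v(xt, q²) t^{2v+1} d_q t`. -/
def planchConst (q : Set.Ioo (0 : ℝ) 1) (v : ℝ) : ℝ :=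
  (1 - (q : ℝ)) ^ 2 * ∑' s : ℤ, weightBase q v ^ s *
    (latticeJ (weightBase q v) ((q : ℝ) ^ 2) s * latticeJ (weightBase q v) ((q : ℝ) ^ 2) s)

include hv in
theorem planchConst_pos : 0 < planchConst q v :=
  mul_pos (pow_pos (sub_pos.2 q.2.2) 2) (tsum_zpow_mul_latticeJ_sq_pos (weightBase_pos q v)
    (weightBase_lt_one q hv) (base_sq_pos q) (base_sq_lt_one q))

theorem inner_kernelIoi (k l : ℕ) :
    inner ℝ (kernelIoi (q := q) hv n k) (kernelIoi hv n l) =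
    (1 - (q : ℝ)) * ∑' s : ℤ, weightBase q v ^ s *
      (latticeJ (weightBase q v) ((q : ℝ) ^ 2) (s + (n + k)) *
        latticeJ (weightBase q v) ((q : ℝ) ^ 2) (s + (n + l))) := by
  rw [inner_LIoi, ← tsum_mul_left]
  refine tsum_congr fun s => ?_
  rw [kernelIoi_apply, kernelIoi_apply, mass, mul_assoc]

theorem inner_kernelIoi_of_ne {k l : ℕ} (h : k ≠ l) :
    inner ℝ (kernelIoi (q := q) hv n k) (kernelIoi hv n l) = 0 := by
  rw [inner_kernelIoi, tsum_zpow_mul_latticeJ_mul_latticeJ_of_ne (weightBase_pos q v)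
    (weightBase_lt_one q hv) (base_sq_pos q) (base_sq_lt_one q) (by omega), mul_zero]

/-- Translating the lattice by `n + k` multiplies the norm sum by `α^{-(n+k)}`, which the mass at
`q^{n+k}` compensates. Hence one constant normalizes all the kernels. -/
theorem mass_mul_inner_kernelIoi_self (k : ℕ) :
    mass q v (n + k) * inner ℝ (kernelIoi (q := q) hv n k) (kernelIoi hv n k) =
      planchConst q v := by
  rw [inner_kernelIoi, planchConst, ← tsum_zpow_mul_latticeJ_sq (weightBase_pos q v)
    (n + k), mass]
  ring

theorem orthonormal_kernelIoi : Orthonormal ℝ fun k : ℕ =>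
    (√(mass q v (n + k)) * (√(planchConst q v))⁻¹) • kernelIoi (q := q) hv n k := by
  rw [orthonormal_iff_ite]
  intro k l
  rw [real_inner_smul_left, real_inner_smul_right]
  split_ifs with h
  · subst h
    have h1 := mass_mul_inner_kernelIoi_self (q := q) (n := n) hv k
    have h2 := Real.mul_self_sqrt (mass_pos q v (n + k)).le
    have h3 := Real.mul_self_sqrt (planchConst_pos (q := q) hv).le
    have h4 := (Real.sqrt_pos.2 (planchConst_pos (q := q) hv)).ne'
    field_simp
    rw [pow_two, pow_two, h2, h3, h1]
  · rw [inner_kernelIoi_of_ne hv h, mul_zero, mul_zero]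

/-- The normalized transform `u ↦ ∫_0^a u(t) j_v(xt, q²) t^{2v+1} d_q t`, as an isometry. -/
def hankel (hv : -1 < v) : LIcc q v n →ₗᵢ[ℝ] LIoi q v :=
  (orthonormal_kernelIoi (q := q) (n := n) hv).orthogonalFamily.linearIsometry.comp
    (deltaIcc q v n).repr.toLinearIsometry

/-- The isometry is defined by a series converging in norm. Point evaluation is continuous, so the
series converges pointwise; one `√mass` from the coefficients and one from the kernels make up the
weight of Jackson's integral. -/
theorem hankel_apply (u : LIcc q v n) (x : Rq q) :
    hankel hv u x = (√(planchConst q v))⁻¹ * besselInt u x := by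
  have hnode : ∀ s : ℤ, hankel hv u (RqNode q s) =
      (√(planchConst q v))⁻¹ * besselInt u (RqNode q s) := by
    intro s
    have h := (orthonormal_kernelIoi (q := q) (n := n) hv).orthogonalFamily.hasSum_linearIsometry
      ((deltaIcc q v n).repr u)
    have h2 := h.mapL (evalIoi v s)
    rw [evalIoi_apply] at h2
    refine h2.tsum_eq.symm.trans ?_
    rw [besselInt_eq, ← tsum_mul_left]
    refine tsum_congr fun k => ?_
    rw [LinearIsometry.toSpanSingleton_apply, map_smul, map_smul, evalIoi_apply, deltaIcc_repr]
    have h3 := Real.mul_self_sqrt (mass_pos q v (n + k)).le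
    rw [smul_eq_mul, smul_eq_mul]
    change _ * (_ * besselJ v (_ * _) _) = _
    linear_combination ((√(planchConst q v))⁻¹ * u (qIntervalNode q n k) *
      besselJ v (RqNode q s * qIntervalNode q n k) ((q : ℝ) ^ 2)) * h3
  obtain ⟨s, hs⟩ := exists_abs_eq_RqNode x
  rw [even_eq_RqNode (hankel hv u).2.1 hs, hnode, ← hs]
  rcases abs_choice (x : ℝ) with h | h <;> rw [h]
  rw [besselInt_neg]

end

/-! ### Uniqueness for expansions in shifts of `J`. -/

section

variable {α p : ℝ} (hα0 : 0 < α) (hα1 : α < 1) (hp0 : 0 < p) (hp1 : p < 1)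
include hα0 hα1 hp0 hp1

theorem summable_mul_latticeJ {a : ℕ → ℝ} (ha : Summable fun k => |a k|) (m : ℕ) (s : ℤ) :
    Summable fun k : ℕ => (p ^ k) ^ m * a k * latticeJ α p (s + k) := by
  obtain ⟨M, hM0, hM⟩ := exists_abs_latticeJ_le_const hα0 hα1 hp0 hp1
  refine Summable.of_norm_bounded (ha.mul_right M) fun k => ?_
  rw [norm_mul, norm_mul, Real.norm_of_nonneg (by positivity), Real.norm_eq_abs, Real.norm_eq_abs]
  refine mul_le_mul ?_ (hM _) (abs_nonneg _) (abs_nonneg _)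
  exact mul_le_of_le_one_left (abs_nonneg _)
    (pow_le_one₀ (by positivity) (pow_le_one₀ hp0.le hp1.le))

/-- The recurrence, applied in `s`, multiplies the coefficient `a k` by `p^k` up to a nonzero factor
independent of `k`. Each application uses `s - 1`, so the half-line of valid `s` loses one point. -/
theorem tsum_pow_mul_latticeJ_eq_zero {a : ℕ → ℝ} (ha : Summable fun k => |a k|) {N : ℤ}
    (h : ∀ s : ℤ, N ≤ s → ∑' k : ℕ, a k * latticeJ α p (s + k) = 0) (m : ℕ) :
    ∀ s : ℤ, N + m ≤ s → ∑' k : ℕ, (p ^ k) ^ m * a k * latticeJ α p (s + k) = 0 := by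
  induction m with
  | zero => simpa using h
  | succ m ih =>
    intro s hs
    push_cast at hs
    have hS := summable_mul_latticeJ hα0 hα1 hp0 hp1 ha
    have h1 := (((hS m (s - 1)).mul_left p).add ((hS m (s + 1)).mul_left α)).tsum_sub
      ((hS m s).mul_left (p + α))
    rw [((hS m (s - 1)).mul_left p).tsum_add ((hS m (s + 1)).mul_left α), tsum_mul_left,
      tsum_mul_left, tsum_mul_left, ih _ (by omega), ih _ (by omega), ih _ (by omega)] at h1
    have h2 : ∑' k : ℕ, -(p * p ^ s) * ((p ^ k) ^ (m + 1) * a k * latticeJ α p (s + k)) = 0 := by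
      simp only [mul_zero, add_zero, sub_zero] at h1
      rw [← h1]
      refine tsum_congr fun k => ?_
      have hr := latticeJ_recurrence hα0 hα1 hp0 hp1 (s + k)
      rw [zpow_add₀ hp0.ne', zpow_natCast] at hr
      have e1 : s - 1 + (k : ℤ) = s + k - 1 := by ring
      have e2 : s + 1 + (k : ℤ) = s + k + 1 := by ring
      rw [e1, e2, pow_succ]
      linear_combination -((p ^ k) ^ m * a k) * hr
    rw [tsum_mul_left] at h2
    exact (mul_eq_zero.1 h2).resolve_left (by have := zpow_pos hp0 s; simp [hp0.ne', this.ne'])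

/-- If `a` vanishes before `K`, divide the relation weighted by `p^{km}` by `p^{Km}` and let `m → ∞`
along `s = N + m`. The terms `k > K` die, `J` tends to `1`, and `a K` is what remains. -/
theorem eq_zero_of_tsum_mul_latticeJ {a : ℕ → ℝ} (ha : Summable fun k => |a k|) {N : ℤ}
    (h : ∀ s : ℤ, N ≤ s → ∑' k : ℕ, a k * latticeJ α p (s + k) = 0) (K : ℕ) : a K = 0 := by
  obtain ⟨M, hM0, hM⟩ := exists_abs_latticeJ_le_const hα0 hα1 hp0 hp1
  induction K using Nat.strong_induction_on with
  | _ K ih =>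
    have hlim : Tendsto (fun m : ℕ => ∑' k : ℕ, (p ^ k / p ^ K) ^ m * a k *
        latticeJ α p (N + k + m)) atTop (𝓝 (∑' k : ℕ, if k = K then a K else 0)) := by
      refine tendsto_tsum_of_dominated_convergence (ha.mul_right M) (fun k => ?_)
        (Eventually.of_forall fun m k => ?_)
      · have hJ := tendsto_latticeJ hα0 hα1 hp0 hp1 (N + k)
        rcases lt_trichotomy k K with hk | rfl | hk
        · simp [ih k hk, hk.ne]
        · simpa [hp0.ne'] using hJ.const_mul (a k)
        · have hlt : p ^ k / p ^ K < 1 :=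
            (div_lt_one (by positivity)).2 (pow_lt_pow_right_of_lt_one₀ hp0 hp1 hk)
          simpa [hk.ne'] using ((tendsto_pow_atTop_nhds_zero_of_lt_one (by positivity)
            hlt).mul_const (a k)).mul hJ
      · rcases lt_or_ge k K with hk | hk
        · simp [ih k hk]
        · rw [norm_mul, norm_mul, Real.norm_of_nonneg (by positivity), Real.norm_eq_abs,
            Real.norm_eq_abs]
          refine mul_le_mul ?_ (hM _) (abs_nonneg _) (abs_nonneg _)
          exact mul_le_of_le_one_left (abs_nonneg _) (pow_le_one₀ (by positivity)
            ((div_le_one (by positivity)).2 (pow_le_pow_of_le_one hp0.le hp1.le hk)))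
    have hzero : ∀ m : ℕ, ∑' k : ℕ, (p ^ k / p ^ K) ^ m * a k *
        latticeJ α p (N + k + m) = 0 := by
      intro m
      have h1 := tsum_pow_mul_latticeJ_eq_zero hα0 hα1 hp0 hp1 ha h m (N + m) le_rfl
      rw [← mul_zero (((p ^ K) ^ m)⁻¹), ← h1, ← tsum_mul_left]
      refine tsum_congr fun k => ?_
      rw [div_pow, add_right_comm N (k : ℤ)]
      ring
    simp only [hzero, tsum_ite_eq] at hlim
    exact (tendsto_nhds_unique hlim tendsto_const_nhds)

end

/-! ### The operator `T`: compactness, symmetry, injectivity. -/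

/-- A norm-summable series of rank one operators is a compact operator. -/
theorem exists_compact_hasSum_smul {E : Type*} [NormedAddCommGroup E] [NormedSpace ℝ E]
    [CompleteSpace E] (φ : ℕ → E →L[ℝ] ℝ) (g : ℕ → E) (h : Summable fun k => ‖φ k‖ * ‖g k‖) :
    ∃ T : E →L[ℝ] E, IsCompactOperator T ∧ ∀ u, HasSum (fun k => φ k u • g k) (T u) := by
  have hs : Summable fun k => (φ k).smulRight (g k) :=
    Summable.of_norm_bounded h fun k => (ContinuousLinearMap.norm_smulRight_apply _ _).le
  refine ⟨∑' k, (φ k).smulRight (g k), ?_, fun u => ?_⟩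
  · refine isCompactOperator_of_tendsto hs.hasSum (Eventually.of_forall fun s => ?_)
    refine (compactOperator (RingHom.id ℝ) E E).sum_mem fun k _ => ?_
    have h1 : IsCompactOperator (id : ℝ → ℝ) := isCompactOperator_id
    exact (h1.comp_clm (φ k)).clm_comp ((ContinuousLinearMap.id ℝ ℝ).smulRight (g k))
  · exact hs.hasSum.mapL (ContinuousLinearMap.apply ℝ E u)

theorem besselJ_qIntervalNode (q : Set.Ioo (0 : ℝ) 1) (v : ℝ) (n : ℤ) (m k : ℕ) :
    besselJ v ((qIntervalNode q n m : ℝ) * (qIntervalNode q n k : ℝ)) ((q : ℝ) ^ 2) =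
      latticeJ (weightBase q v) ((q : ℝ) ^ 2) (n + m + (n + k)) := by
  rw [← besselJ_node, coe_qIntervalNode q n m, coe_RqNode]

/-- The kernel `x ↦ j_v(xt, q²)` on `[0, a]_q`, for `t = a q^k`. -/
def kernelIcc (hv : -1 < v) (n : ℤ) (k : ℕ) : LIcc q v n :=
  ⟨fun x => besselJ v (x * qIntervalNode q n k) ((q : ℝ) ^ 2), mem_subIcc_iff.2 (by
    obtain ⟨M, hM0, hM⟩ := exists_abs_latticeJ_le_const (weightBase_pos q v)
      (weightBase_lt_one q hv) (base_sq_pos q) (base_sq_lt_one q)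
    refine Summable.of_nonneg_of_le (fun m => mul_nonneg (mass_pos q v _).le (sq_nonneg _))
      (fun m => ?_) ((summable_mass (q := q) hv n).mul_right (M ^ 2))
    refine mul_le_mul_of_nonneg_left ?_ (mass_pos q v _).le
    rw [besselJ_qIntervalNode, ← sq_abs]
    exact pow_le_pow_left₀ (abs_nonneg _) (hM _) 2)⟩

theorem kernelIcc_apply (hv : -1 < v) (k m : ℕ) :
    kernelIcc hv n k (qIntervalNode q n m) =
      latticeJ (weightBase q v) ((q : ℝ) ^ 2) (n + m + (n + k)) :=
  besselJ_qIntervalNode q v n m k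

theorem exists_norm_kernelIcc_le (q : Set.Ioo (0 : ℝ) 1) (hv : -1 < v) (n : ℤ) :
    ∃ B : ℝ, 0 ≤ B ∧ ∀ k, ‖(kernelIcc hv n k : LIcc q v n)‖ ≤ B := by
  obtain ⟨M, hM0, hM⟩ := exists_abs_latticeJ_le_const (weightBase_pos q v)
    (weightBase_lt_one q hv) (base_sq_pos q) (base_sq_lt_one q)
  have hs := summable_mass (q := q) hv n
  refine ⟨√(∑' m : ℕ, mass q v (n + m) * (M * M)), Real.sqrt_nonneg _, fun k => ?_⟩
  refine Real.le_sqrt_of_sq_le ?_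
  rw [← real_inner_self_eq_norm_sq, inner_LIcc]
  have hle : ∀ m : ℕ, mass q v (n + m) * (kernelIcc hv n k (qIntervalNode q n m) *
      kernelIcc hv n k (qIntervalNode q n m)) ≤ mass q v (n + m) * (M * M) := fun m => by
    refine mul_le_mul_of_nonneg_left ?_ (mass_pos q v _).le
    rw [kernelIcc_apply, ← abs_mul_abs_self]
    exact mul_le_mul (hM _) (hM _) (abs_nonneg _) hM0
  exact Summable.tsum_le_tsum hle (Summable.of_nonneg_of_le
    (fun m => mul_nonneg (mass_pos q v _).le (mul_self_nonneg _)) hle (hs.mul_right _))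
    (hs.mul_right _)

theorem summable_sqrt_mass (q : Set.Ioo (0 : ℝ) 1) (hv : -1 < v) (n : ℤ) :
    Summable fun k : ℕ => √(mass q v (n + k)) := by
  have h1 : √(weightBase q v) < 1 := by
    rw [Real.sqrt_lt' one_pos, one_pow]; exact weightBase_lt_one q hv
  refine ((summable_geometric_of_lt_one (Real.sqrt_nonneg _) h1).mul_left
    (√(mass q v n))).congr fun k => ?_
  have h2 : mass q v (n + k) = mass q v n * (√(weightBase q v) ^ k) ^ 2 := by
    rw [← pow_mul, mul_comm k 2, pow_mul, Real.sq_sqrt (weightBase_pos q v).le, mass, mass,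
      zpow_add₀ (weightBase_pos q v).ne', zpow_natCast, mul_assoc]
  rw [h2, Real.sqrt_mul (mass_pos q v n).le, Real.sqrt_sq (by positivity)]

theorem inner_kernelIcc (hv : -1 < v) (k : ℕ) (u : LIcc q v n) :
    inner ℝ (kernelIcc hv n k) u = besselInt u (qIntervalNode q n k) := by
  rw [inner_LIcc, besselInt_eq]
  refine tsum_congr fun m => ?_
  change _ * (besselJ v (_ * _) _ * _) = _
  rw [mul_comm (qIntervalNode q n m : ℝ), mul_comm (besselJ _ _ _)]

/-- `T` is the sum over `k` of evaluation at `a q^k` times a multiple of the kernel there.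
Evaluation has norm at most `mass^{-1/2}`, the coefficient contains `mass`, and the kernels are
uniformly bounded, so the norms are dominated by the summable `√mass`. Symmetry is that of `j_v(xt,
q²)` in `x` and `t`. -/
theorem exists_prolateOperator (q : Set.Ioo (0 : ℝ) 1) (hv : -1 < v) (n : ℤ) :
    ∃ T : LIcc q v n →L[ℝ] LIcc q v n, IsProlateOperator T ∧ IsCompactOperator T ∧
      (T : LIcc q v n →ₗ[ℝ] LIcc q v n).IsSymmetric := by
  obtain ⟨B, hB0, hB⟩ := exists_norm_kernelIcc_le q hv n
  have hsum : Summable fun k : ℕ => ‖(evalIcc v n k : LIcc q v n →L[ℝ] ℝ)‖ *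
      ‖(cConst q v * mass q v (n + k)) • (kernelIcc hv n k : LIcc q v n)‖ := by
    refine Summable.of_nonneg_of_le (fun k => by positivity) (fun k => ?_)
      ((summable_sqrt_mass q hv n).mul_right (|cConst q v| * B))
    have hm := Real.sqrt_pos.2 (mass_pos q v (n + k))
    rw [norm_smul, norm_mul, Real.norm_eq_abs, Real.norm_of_nonneg (mass_pos q v _).le]
    calc _ ≤ (√(mass q v (n + k)))⁻¹ * (|cConst q v| * mass q v (n + k) * B) := by
          have hm' : 0 ≤ |cConst q v| * mass q v (n + k) :=
            mul_nonneg (abs_nonneg _) (mass_pos q v _).le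
          exact mul_le_mul (norm_evalIcc_le k) (mul_le_mul_of_nonneg_left (hB k) hm')
            (mul_nonneg hm' (norm_nonneg _)) (by positivity)
      _ = (√(mass q v (n + k)))⁻¹ * (|cConst q v| * (√(mass q v (n + k)) *
            √(mass q v (n + k))) * B) := by rw [Real.mul_self_sqrt (mass_pos q v _).le]
      _ = _ := by field_simp
  obtain ⟨T, hT, hTs⟩ := exists_compact_hasSum_smul _ _ hsum
  have hTapp : ∀ (u : LIcc q v n) (m : ℕ),
      T u (qIntervalNode q n m) = cConst q v * besselInt u (qIntervalNode q n m) := by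
    intro u m
    have h := (hTs u).mapL (evalIcc v n m)
    rw [evalIcc_apply] at h
    rw [← h.tsum_eq, besselInt_eq, ← tsum_mul_left]
    refine tsum_congr fun k => ?_
    rw [map_smul, map_smul, evalIcc_apply, evalIcc_apply, kernelIcc_apply, besselJ_qIntervalNode,
      smul_eq_mul, smul_eq_mul]
    ring
  refine ⟨T, fun u x => ?_, hT, fun u w => ?_⟩
  · obtain ⟨m, rfl⟩ := exists_eq_qIntervalNode x
    exact hTapp u m
  · have h := (hTs u).mapL (innerSL ℝ w)
    have h2 : inner ℝ w (T u) = inner ℝ u (T w) := by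
      refine h.tsum_eq.symm.trans ?_
      rw [inner_LIcc]
      refine tsum_congr fun k => ?_
      change inner ℝ w _ = _
      rw [real_inner_smul_right, real_inner_smul_right, real_inner_comm, inner_kernelIcc, hTapp,
        evalIcc_apply]
      ring
    exact (real_inner_comm _ _).trans h2

theorem cConst_pos (q : Set.Ioo (0 : ℝ) 1) (hv : -1 < v) : 0 < cConst q v := by
  refine mul_pos (one_div_pos.2 (sub_pos.2 q.2.2)) (div_pos ?_ ?_)
  · exact qPochInf_pos (weightBase_pos q v).le (weightBase_lt_one q hv) (base_sq_pos q)
      (base_sq_lt_one q)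
  · exact qPochInf_pos (base_sq_pos q).le (base_sq_lt_one q) (base_sq_pos q) (base_sq_lt_one q)

theorem summable_abs_mass_mul (hv : -1 < v) (u : LIcc q v n) :
    Summable fun k : ℕ => |mass q v (n + k) * u (qIntervalNode q n k)| := by
  have h := summable_mul_of_sq (fun k : ℕ => (mass_pos q v (n + k)).le)
    (f := fun _ => 1) (by simpa using summable_mass (q := q) hv n) (mem_subIcc_iff.1 u.2)
  simpa using h.abs

/-- Here the transform is known to vanish only on `[0, a]_q`, so the isometry on `ℝ_q` does not
suffice. The relations hold for `s ≥ 2n`, since both `x` and `t` are at most `a = q^n`, and the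
uniqueness result for a half-line applies. -/
theorem eq_zero_of_prolateOperator_eq_zero (hv : -1 < v) {T : LIcc q v n →L[ℝ] LIcc q v n}
    (hT : IsProlateOperator T) {u : LIcc q v n} (hu : T u = 0) : u = 0 := by
  refine LIcc_ext fun k => ?_
  have h := eq_zero_of_tsum_mul_latticeJ (weightBase_pos q v) (weightBase_lt_one q hv)
    (base_sq_pos q) (base_sq_lt_one q) (summable_abs_mass_mul hv u) (N := n + n)
    (fun s hs => ?_) k
  · exact (mul_eq_zero.1 h).resolve_left (mass_pos q v _).ne'
  · obtain ⟨m, rfl⟩ := Int.le.dest hs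
    have h1 := hT u (qIntervalNode q n m)
    rw [hu] at h1
    have h2 := (mul_eq_zero.1 h1.symm).resolve_left (cConst_pos q hv).ne'
    rw [besselInt_eq] at h2
    refine Eq.trans (tsum_congr fun k => ?_) h2
    rw [besselJ_qIntervalNode, mul_assoc]
    congr 3
    ring

/-! ### The spectral theorem with eigenvalues ordered by their squares. -/

/-- A positive function with finite superlevel sets can be enumerated in decreasing order. -/
theorem exists_antitone_enumeration {ι : Type*} [Infinite ι] {r : ι → ℝ} (hr : ∀ i, 0 < r i)
    (hfin : ∀ ε > 0, {i | ε ≤ r i}.Finite) :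
    ∃ e : ℕ → ι, Function.Injective e ∧ Function.Surjective e ∧ Antitone (r ∘ e) := by
  classical
  have hmax : ∀ S : Finset ι, ∃ i, i ∉ S ∧ ∀ j, j ∉ S → r j ≤ r i := by
    intro S
    obtain ⟨i₀, hi₀⟩ := Infinite.exists_notMem_finset S
    obtain ⟨i, hi, him⟩ := Set.exists_max_image {j | j ∉ S ∧ r i₀ ≤ r j} r
      ((hfin _ (hr i₀)).subset fun j hj => hj.2) ⟨i₀, hi₀, le_rfl⟩
    refine ⟨i, hi.1, fun j hj => ?_⟩
    rcases le_total (r i₀) (r j) with h | h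
    · exact him j ⟨hj, h⟩
    · exact h.trans hi.2
  -- Greedy enumeration: `next S` maximizes `r` off the finite set `S`. An index never chosen would
  -- lie below infinitely many chosen values, against the finiteness of superlevel sets.
  choose next hnext hle using hmax
  let S : ℕ → Finset ι := fun m => Nat.rec ∅ (fun _ A => insert (next A) A) m
  have hS : ∀ m, S (m + 1) = insert (next (S m)) (S m) := fun m => rfl
  have hSmono : Monotone S := monotone_nat_of_le_succ fun m => by
    rw [hS]; exact Finset.subset_insert _ _
  have hmem : ∀ m k, m < k → next (S m) ∈ S k := fun m k h =>
    hSmono (Nat.succ_le_of_lt h) (by rw [hS]; exact Finset.mem_insert_self _ _)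
  have hinj : Function.Injective fun m => next (S m) := by
    intro m k h
    change next (S m) = next (S k) at h
    by_contra hne
    rcases lt_or_gt_of_ne hne with hlt | hlt
    · exact hnext (S k) (h ▸ hmem m k hlt)
    · exact hnext (S m) (h.symm ▸ hmem k m hlt)
  refine ⟨fun m => next (S m), hinj, fun i => ?_, antitone_nat_of_succ_le fun m => ?_⟩
  · by_contra hi
    have hiS : ∀ m, i ∉ S m := by
      intro m
      induction m with
      | zero => exact Finset.notMem_empty i
      | succ m ih =>
        rw [hS, Finset.mem_insert, not_or]
        exact ⟨fun h => hi ⟨m, h.symm⟩, ih⟩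
    exact Set.infinite_of_injective_forall_mem hinj (fun m => hle (S m) i (hiS m))
      (hfin (r i) (hr i))
  · refine hle (S m) _ fun h => hnext (S (m + 1)) ?_
    exact hSmono (Nat.le_succ m) h

section

variable {E : Type*} [NormedAddCommGroup E] [InnerProductSpace ℝ E]

open Module.End

/-- For a compact operator, orthonormal eigenvectors have eigenvalues accumulating only at `0`. -/
theorem finite_setOf_le_sq_eigenvalue {T : E →L[ℝ] E} (hT : IsCompactOperator T) {ι : Type*}
    {e : ι → E} (he : Orthonormal ℝ e) {lam : ι → ℝ} (hlam : ∀ i, T (e i) = lam i • e i)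
    {ε : ℝ} (hε : 0 < ε) : {i | ε ≤ lam i ^ 2}.Finite := by
  by_contra hinf
  have hinj := (Set.infinite_coe_iff.2 hinf).natEmbedding
  have hK := hT.isCompact_closure_image_closedBall 1
  obtain ⟨a, -, φ, hφ, hlim⟩ := hK.tendsto_subseq (x := fun m => T (e (hinj m))) fun m =>
    subset_closure ⟨e (hinj m), by simp [he.1], rfl⟩
  obtain ⟨N, hN⟩ := Metric.cauchySeq_iff.1 hlim.cauchySeq (√ε) (Real.sqrt_pos.2 hε)
  have hd := hN N le_rfl (N + 1) N.le_succ
  have hne : (hinj (φ N) : ι) ≠ hinj (φ (N + 1)) := fun h =>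
    (hφ N.lt_succ_self).ne (hinj.injective (Subtype.ext h))
  -- By Pythagoras, images of distinct eigenvectors in the set are at distance at least `√ε`, so no
  -- subsequence is Cauchy.
  have h1 : dist (T (e (hinj (φ N)))) (T (e (hinj (φ (N + 1))))) ^ 2 =
      lam (hinj (φ N)) ^ 2 + lam (hinj (φ (N + 1))) ^ 2 := by
    rw [dist_eq_norm, @norm_sub_sq_real, hlam, hlam, real_inner_smul_left, real_inner_smul_right,
      he.2 hne, norm_smul, norm_smul, he.1, he.1]
    simp
  have h2 := pow_lt_pow_left₀ hd dist_nonneg two_ne_zero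
  rw [Real.sq_sqrt hε.le] at h2
  have h3 : ε ≤ lam (hinj (φ N)) ^ 2 := (hinj (φ N)).2
  have h4 := sq_nonneg (lam (hinj (φ (N + 1))))
  simp only [Function.comp_apply] at h2
  linarith

/-- The spectral theorem for an injective compact symmetric operator on an infinite-dimensional
Hilbert space, with the eigenvalues in decreasing order. -/
theorem exists_orthonormal_eigenvectors [CompleteSpace E] (hE : ¬ FiniteDimensional ℝ E)
    {T : E →L[ℝ] E} (hT : IsCompactOperator T) (hsymm : (T : E →ₗ[ℝ] E).IsSymmetric)
    (hinj : ∀ u, T u = 0 → u = 0) :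
    ∃ (lam : ℕ → ℝ) (e : ℕ → E), Orthonormal ℝ e ∧ (∀ i, T (e i) = lam i • e i) ∧
      (∀ (μ : ℝ) (w : E), HasEigenvector (T : E →ₗ[ℝ] E) μ w →
        w ∈ Submodule.span ℝ (Set.range e)) ∧ Antitone fun i => lam i ^ 2 := by
  have hker : ∀ w, w ∈ eigenspace (T : E →ₗ[ℝ] E) 0 → w = 0 := fun w hw =>
    hinj w (by simpa using mem_eigenspace_iff.1 hw)
  have hfd : ∀ μ, FiniteDimensional ℝ (eigenspace (T : E →ₗ[ℝ] E) μ) := by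
    intro μ
    by_cases hμ : μ = 0
    · have : eigenspace (T : E →ₗ[ℝ] E) μ = ⊥ := by
        rw [hμ]; exact (Submodule.eq_bot_iff _).2 hker
      rw [this]
      infer_instance
    · exact ContinuousLinearMap.finite_dimensional_eigenspace hT μ hμ
  let b := fun μ => stdOrthonormalBasis ℝ (eigenspace (T : E →ₗ[ℝ] E) μ)
  -- The index runs over all real `μ`; the fibre is empty unless `μ` is an eigenvalue.
  let e : (Σ μ : ℝ, Fin (Module.finrank ℝ (eigenspace (T : E →ₗ[ℝ] E) μ))) → E :=
    fun i => (b i.1 i.2 : E)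
  have he : Orthonormal ℝ e :=
    hsymm.orthogonalFamily_eigenspaces.orthonormal_sigma_orthonormal
      (v_family := fun μ i => b μ i) fun μ => (b μ).orthonormal
  have hTe : ∀ i, T (e i) = i.1 • e i := fun i => mem_eigenspace_iff.1 (b i.1 i.2).2
  have hspan : ∀ μ, eigenspace (T : E →ₗ[ℝ] E) μ ≤ Submodule.span ℝ (Set.range e) := by
    intro μ w hw
    have h := congrArg Subtype.val ((b μ).sum_repr ⟨w, hw⟩)
    rw [Submodule.coe_sum] at h
    change _ = w at h
    rw [← h]
    exact Submodule.sum_mem _ fun i _ =>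
      Submodule.smul_mem _ _ (Submodule.subset_span ⟨⟨μ, i⟩, rfl⟩)
  have hpos : ∀ i : (Σ μ : ℝ, Fin (Module.finrank ℝ (eigenspace (T : E →ₗ[ℝ] E) μ))),
      0 < i.1 ^ 2 := by
    intro i
    refine sq_pos_of_ne_zero fun h0 => he.ne_zero i (hinj _ ?_)
    rw [hTe, h0, zero_smul]
  -- Finitely many eigenvectors would span a closed subspace with trivial orthogonal complement,
  -- hence all of `E`.
  have hinf : Infinite (Σ μ : ℝ, Fin (Module.finrank ℝ (eigenspace (T : E →ₗ[ℝ] E) μ))) := by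
    by_contra hfin
    rw [not_infinite_iff_finite] at hfin
    have hf : FiniteDimensional ℝ (Submodule.span ℝ (Set.range e)) :=
      FiniteDimensional.span_of_finite ℝ (Set.finite_range e)
    have h1 := ContinuousLinearMap.orthogonalComplement_iSup_eigenspaces_eq_bot hT hsymm
    have h2 : (Submodule.span ℝ (Set.range e))ᗮ = ⊥ :=
      eq_bot_iff.2 (h1 ▸ Submodule.orthogonal_le (iSup_le hspan))
    rw [Submodule.orthogonal_eq_bot_iff] at h2
    rw [h2] at hf
    exact hE (Module.Finite.equiv (Submodule.topEquiv (R := ℝ) (M := E)))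
  obtain ⟨enum, h1, h2, h3⟩ := exists_antitone_enumeration hpos fun ε hε =>
    finite_setOf_le_sq_eigenvalue hT he hTe hε
  refine ⟨fun m => (enum m).1, fun m => e (enum m), he.comp enum h1, fun m => hTe _, ?_, h3⟩
  intro μ w hw
  have h4 : Set.range (fun m => e (enum m)) = Set.range e := h2.range_comp e
  rw [h4]
  exact hspan μ hw.1

end

/-! ### Prolate systems and the Paley-Wiener space. -/

theorem not_finiteDimensional_LIcc : ¬ FiniteDimensional ℝ (LIcc q v n) := by
  intro h
  have := (deltaIcc q v n).orthonormal.linearIndependent.finite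
  exact not_finite ℕ

theorem besselInt_eq_hankel (hv : -1 < v) (u : LIcc q v n) (x : Rq q) :
    besselInt u x = √(planchConst q v) * hankel hv u x := by
  rw [hankel_apply, mul_inv_cancel_left₀ (Real.sqrt_pos.2 (planchConst_pos hv)).ne']

/-- Plancherel for `hankel`: it turns the normalization of `ψ_i` on `ℝ_q` into a norm condition on
`u_i` over `[0, a]_q`. -/
theorem jacksonIoi_besselInt_sq (hv : -1 < v) (r : ℝ) (u : LIcc q v n) :
    jacksonIoi q (fun t => (r * besselInt u t) ^ 2 * (t : ℝ) ^ (2 * v + 1)) =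
      ‖(r * √(planchConst q v)) • u‖ ^ 2 := by
  rw [← (hankel hv).norm_map, ← real_inner_self_eq_norm_sq, inner_LIoi, map_smul]
  refine (jacksonIoi_eq fun t : Rq q => (r * besselInt u t) ^ 2).trans (tsum_congr fun s => ?_)
  change _ = mass q v s * ((r * √(planchConst q v) * hankel hv u (RqNode q s)) *
    (r * √(planchConst q v) * hankel hv u (RqNode q s)))
  rw [besselInt_eq_hankel hv]
  ring

theorem exists_prolateSystem (hv : -1 < v) {T : LIcc q v n →L[ℝ] LIcc q v n}
    (hT : IsProlateOperator T) (hc : IsCompactOperator T)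
    (hs : (T : LIcc q v n →ₗ[ℝ] LIcc q v n).IsSymmetric) :
    ∃ (lam : ℕ → ℝ) (u : ℕ → LIcc q v n) (ψ : ℕ → Rq q → ℝ),
      IsProlateSystem T lam u ψ ∧ Antitone fun i => lam i ^ 2 := by
  obtain ⟨lam, e, he, hTe, hspan, hanti⟩ := exists_orthonormal_eigenvectors
    not_finiteDimensional_LIcc hc hs fun u => eq_zero_of_prolateOperator_eq_zero hv hT
  have hlam : ∀ i, lam i ≠ 0 := fun i h0 => he.ne_zero i
    (eq_zero_of_prolateOperator_eq_zero hv hT (by rw [hTe, h0, zero_smul]))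
  have hD := (Real.sqrt_pos.2 (planchConst_pos (q := q) hv)).ne'
  have hC := (cConst_pos q hv).ne'
  -- This scaling of the unit vector `e i` is the one for which its extension has norm `1` on `ℝ_q`.
  set t : ℕ → ℝ := fun i => lam i / (cConst q v * √(planchConst q v)) with ht
  have ht0 : ∀ i, t i ≠ 0 := fun i => div_ne_zero (hlam i) (mul_ne_zero hC hD)
  refine ⟨lam, fun i => t i • e i,
    fun i x => (lam i)⁻¹ * (cConst q v * besselInt (t i • e i) x), ?_, hanti⟩
  refine
    { eigen := fun i => ⟨Module.End.mem_eigenspace_iff.2 ?_, smul_ne_zero (ht0 i) (he.ne_zero i)⟩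
      orth := fun i j hij _ => ?_
      exhaust := fun μ w hw => ?_
      extend := fun i x => rfl
      normalized := fun i => ?_ }
  · change T (t i • e i) = _
    rw [map_smul, hTe, smul_comm]
  · rw [real_inner_smul_left, real_inner_smul_right, he.2 hij, mul_zero, mul_zero]
  · refine Submodule.span_le.2 ?_ (hspan μ w hw)
    rintro _ ⟨i, rfl⟩
    have h := Submodule.smul_mem (Submodule.span ℝ (Set.range fun i => t i • e i)) (t i)⁻¹
      (Submodule.subset_span ⟨i, rfl⟩)
    rwa [inv_smul_smul₀ (ht0 i)] at h
  · simp only [← mul_assoc]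
    rw [jacksonIoi_besselInt_sq hv, smul_smul]
    have h1 : (lam i)⁻¹ * cConst q v * √(planchConst q v) * t i = 1 := by
      have := hlam i
      rw [ht]
      field_simp
    rw [h1, one_smul, he.1, one_pow]

variable {T : LIcc q v n →L[ℝ] LIcc q v n} {lam : ℕ → ℝ} {u : ℕ → LIcc q v n}
  {ψ : ℕ → Rq q → ℝ}

theorem IsProlateSystem.apply_eigen (h : IsProlateSystem T lam u ψ) (i : ℕ) :
    T (u i) = lam i • u i := Module.End.mem_eigenspace_iff.1 (h.eigen i).1

theorem IsProlateSystem.eigenvalue_ne_zero (h : IsProlateSystem T lam u ψ) (hv : -1 < v)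
    (hT : IsProlateOperator T) (i : ℕ) : lam i ≠ 0 := fun h0 =>
  (h.eigen i).2 (eq_zero_of_prolateOperator_eq_zero hv hT (by rw [h.apply_eigen, h0, zero_smul]))

theorem IsProlateSystem.eq_on_qInterval (h : IsProlateSystem T lam u ψ) (hv : -1 < v)
    (hT : IsProlateOperator T) (i : ℕ) (x : qInterval q n) (y : Rq q) (hxy : (x : ℝ) = y) :
    ψ i y = u i x := by
  rw [h.extend, ← hxy, ← hT, h.apply_eigen]
  exact inv_mul_cancel_left₀ (h.eigenvalue_ne_zero hv hT i) _

theorem IsProlateSystem.inner_eq_zero (h : IsProlateSystem T lam u ψ)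
    (hs : (T : LIcc q v n →ₗ[ℝ] LIcc q v n).IsSymmetric) {i j : ℕ} (hij : i ≠ j) :
    inner ℝ (u i) (u j) = 0 := by
  by_cases hl : lam i = lam j
  · exact h.orth i j hij hl
  · have h1 : inner ℝ (T (u i)) (u j) = inner ℝ (u i) (T (u j)) := hs (u i) (u j)
    rw [h.apply_eigen, h.apply_eigen, real_inner_smul_left, real_inner_smul_right] at h1
    exact (mul_eq_zero.1 (by linear_combination h1 :
      (lam i - lam j) * inner ℝ (u i) (u j) = 0)).resolve_left (sub_ne_zero.2 hl)

/-- Every eigenspace lies in the span of the `u i`, so completeness of the eigenspaces passes to the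
system. The scaling `t` is left free for two uses: `‖u i‖⁻¹` for the basis of `L_{q,v,a}`, and the
factor from the normalization of `ψ i`. -/
theorem IsProlateSystem.exists_hilbertBasis (h : IsProlateSystem T lam u ψ)
    (hc : IsCompactOperator T) (hs : (T : LIcc q v n →ₗ[ℝ] LIcc q v n).IsSymmetric)
    {t : ℕ → ℝ} (ht : ∀ i, ‖t i • u i‖ = 1) :
    ∃ b : HilbertBasis ℕ ℝ (LIcc q v n), ∀ i, b i = t i • u i := by
  have ht0 : ∀ i, t i ≠ 0 := fun i h0 => by
    have := ht i
    rw [h0, zero_smul, norm_zero] at this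
    exact zero_ne_one this
  have ho : Orthonormal ℝ fun i => t i • u i := ⟨ht, fun i j hij => by
    change inner ℝ (t i • u i) (t j • u j) = 0
    rw [real_inner_smul_left, real_inner_smul_right, h.inner_eq_zero hs hij, mul_zero, mul_zero]⟩
  have hspan : ∀ μ, Module.End.eigenspace (T : LIcc q v n →ₗ[ℝ] LIcc q v n) μ ≤
      Submodule.span ℝ (Set.range fun i => t i • u i) := by
    intro μ w hw
    by_cases hw0 : w = 0
    · rw [hw0]; exact Submodule.zero_mem _
    · refine Submodule.span_le.2 ?_ (h.exhaust μ w ⟨hw, hw0⟩)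
      rintro _ ⟨i, rfl⟩
      have h1 := Submodule.smul_mem (Submodule.span ℝ (Set.range fun i => t i • u i)) (t i)⁻¹
        (Submodule.subset_span ⟨i, rfl⟩)
      rwa [inv_smul_smul₀ (ht0 i)] at h1
  have hbot := ContinuousLinearMap.orthogonalComplement_iSup_eigenspaces_eq_bot hc hs
  have hbot' : (Submodule.span ℝ (Set.range fun i => t i • u i))ᗮ = ⊥ :=
    eq_bot_iff.2 (hbot ▸ Submodule.orthogonal_le (iSup_le hspan))
  exact ⟨HilbertBasis.mkOfOrthogonalEqBot ho hbot', fun i => by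
    rw [HilbertBasis.coe_mkOfOrthogonalEqBot]⟩

theorem image_range_hankel (hv : -1 < v) :
    (fun (f : LIoi q v) (x : Rq q) => f x) ''
      (LinearMap.range (hankel (q := q) (n := n) hv).toLinearMap : Set (LIoi q v)) =
        PW q v n := by
  have hD := (Real.sqrt_pos.2 (planchConst_pos (q := q) hv)).ne'
  ext f
  constructor
  · rintro ⟨_, ⟨u, rfl⟩, rfl⟩
    refine ⟨(√(planchConst q v))⁻¹ • u, fun x => ?_⟩
    rw [besselInt_eq_hankel hv, map_smul]
    exact (mul_inv_cancel_left₀ hD _).symm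
  · rintro ⟨u, hu⟩
    refine ⟨hankel hv (√(planchConst q v) • u), ⟨_, rfl⟩, funext fun x => ?_⟩
    rw [hu, besselInt_eq_hankel hv, map_smul]
    rfl

/-- With the factor `λ_i⁻¹ c_{q,v} √planchConst`, the scaled `u i` are unit vectors by `normalized`,
and `hankel` sends them exactly to the `ψ i`. An isometry carries a Hilbert basis to one of its
range. -/
theorem IsProlateSystem.exists_hilbertBasis_range_hankel (h : IsProlateSystem T lam u ψ)
    (hv : -1 < v) (hc : IsCompactOperator T)
    (hs : (T : LIcc q v n →ₗ[ℝ] LIcc q v n).IsSymmetric) :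
    ∃ b : HilbertBasis ℕ ℝ (LinearMap.range (hankel (q := q) (n := n) hv).toLinearMap),
      ∀ (i : ℕ) (x : Rq q), (b i : LIoi q v) x = ψ i x := by
  have ht : ∀ i, ‖((lam i)⁻¹ * cConst q v * √(planchConst q v)) • u i‖ = 1 := by
    intro i
    have h1 := h.normalized i
    simp only [h.extend, ← mul_assoc] at h1
    rw [jacksonIoi_besselInt_sq hv] at h1
    exact (pow_eq_one_iff_of_nonneg (norm_nonneg _) two_ne_zero).1 h1
  obtain ⟨b, hb⟩ := h.exists_hilbertBasis hc hs ht
  refine ⟨HilbertBasis.ofRepr ((hankel hv).equivRange.symm.trans b.repr), fun i x => ?_⟩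
  change hankel hv (b i) x = ψ i x
  rw [hb, h.extend, besselInt_eq_hankel hv, map_smul]
  change _ * hankel hv (u i) x = _
  ring

end QFourier

end

theorem proposition5 (q : Set.Ioo (0 : ℝ) 1) (v : ℝ) (hv : -1 < v) (n : ℤ) :
    ∃ T : QFourier.LIcc q v n →L[ℝ] QFourier.LIcc q v n,
      QFourier.IsProlateOperator T ∧
      IsCompactOperator T ∧
      (T : QFourier.LIcc q v n →ₗ[ℝ] QFourier.LIcc q v n).IsSymmetric ∧
      (∃ (lam : ℕ → ℝ) (u : ℕ → QFourier.LIcc q v n) (ψ : ℕ → QFourier.Rq q → ℝ),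
        QFourier.IsProlateSystem T lam u ψ ∧ Antitone (fun i => lam i ^ 2)) ∧
      ∀ (lam : ℕ → ℝ) (u : ℕ → QFourier.LIcc q v n) (ψ : ℕ → QFourier.Rq q → ℝ),
        QFourier.IsProlateSystem T lam u ψ →
        (∀ (i : ℕ) (x : QFourier.qInterval q n) (y : QFourier.Rq q),
          (x : ℝ) = (y : ℝ) → ψ i y = u i x) ∧
        (∃ b : HilbertBasis ℕ ℝ (QFourier.LIcc q v n), ∀ i, b i = ‖u i‖⁻¹ • u i) ∧
        ∃ P : Submodule ℝ (QFourier.LIoi q v),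
          (fun (f : QFourier.LIoi q v) (x : QFourier.Rq q) => f x) '' (P : Set (QFourier.LIoi q v))
            = QFourier.PW q v n ∧
          ∃ b : HilbertBasis ℕ ℝ P, ∀ (i : ℕ) (x : QFourier.Rq q),
            (b i : QFourier.LIoi q v) x = ψ i x := by
  obtain ⟨T, hT, hc, hs⟩ := QFourier.exists_prolateOperator q hv n
  refine ⟨T, hT, hc, hs, QFourier.exists_prolateSystem hv hT hc hs, fun lam u ψ h =>
    ⟨h.eq_on_qInterval hv hT, ?_, _, QFourier.image_range_hankel hv,
      h.exists_hilbertBasis_range_hankel hv hc hs⟩⟩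
  exact h.exists_hilbertBasis hc hs fun i => norm_smul_inv_norm (𝕜 := ℝ) (h.eigen i).2
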